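/- Let $X, X_1, X_2, \dots$ be independent, identically distributed real random variables with distribution function $F$ and $E(X^2)<\infty$. Let $t_0\in(0,1)$, let $\psi_{t_0}=\inf\{x: F(x)\ge t_0\}$, and suppose that $F$ is continuous in a neighbourhood of $\psi_{t_0}$ and that $F(x)>t_0$ for all $x>\psi_{t_0}$. Let $\theta(t_0)=E[X\,I(X\le\psi_{t_0})]$ be the generalized Lorenz ordinate, and put $\sigma_p^2=\mathrm{Var}\big(X\,I(X\le\psi_{t_0})\big)$ and $\sigma_v^2=\mathrm{Var}\big((X-\psi_{t_0})\,I(X\le\psi_{t_0})\big)$. Let $F_n$ be the empirical distribution function of $X_1,\dots,X_n$ and $\widehat\psi_{t_0}=\inf\{x:F_n(x)\ge t_0\}$ the sample quantile. For $1\le i\le n$ put $\widehat W_i=X_i I(X_i\le\widehat\psi_{t_0})-\theta(t_0)$ and $W_i=X_i I(X_i\le\psi_{t_0})-\theta(t_0)$. Let $a_n$ be real random variables with $a_n=o_p(n^{2/3})$ (for example $a_n=\max\{1,\tfrac12\log n\}$). Add the pseudo-observation $\widehat W_{n+1}=-a_n\overline W_n$, where $\overline W_n$ is either $\frac1n\sum_{i=1}^n\widehat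 W_i$ or $\frac1n\sum_{i=1}^n W_i$. The adjusted empirical likelihood and the adjusted empirical log-likelihood ratio are $$L^*(\theta(t_0))=\sup\Big\{\prod_{i=1}^{n+1}p_i:\ p_i\ge0,\ \sum_{i=1}^{n+1}p_i=1,\ \sum_{i=1}^{n+1}p_i\widehat W_i=0\Big\},\qquad \ell^*(\theta(t_0))=-2\log\big\{(n+1)^{n+1}L^*(\theta(t_0))\big\}.$$ Thus $\ell^*(\theta(t_0))=2\sum_{i=1}^{n+1}\log(1+\lambda\widehat W_i)$ whenever $\lambda$ satisfies $\sum_{i=1}^{n+1}\widehat W_i/(1+\lambda\widehat W_i)=0$ and $1+\lambda\widehat W_i>0$ for all $i$. If no weight vector with all $p_i>0$ satisfies the constraints, $\ell^*(\theta(t_0))$ is given the value $0$. Then, for either choice of $\overline W_n$, $$\frac{\sigma_p^2}{\sigma_v^2}\,\ell^*(\theta(t_0))\longrightarrow\chi^2_1\quad\text{in distribution as } n\to\infty.$$ -/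

import Mathlib

open MeasureTheory ProbabilityTheory Filter Topology

noncomputable section

namespace GenLorenz

/-- The quantile `ψ_t = inf {x : F(x) ≥ t}` of a law `μ` on the real line with distribution
function `F`. -/
def quantile (μ : Measure ℝ) (t : ℝ) : ℝ := sInf {x : ℝ | t ≤ cdf μ x}

/-- The empirical distribution function of the data `x₁, …, xₙ`. -/
def empiricalCDF {n : ℕ} (x : Fin n → ℝ) (s : ℝ) : ℝ :=
  ((Finset.univ.filter fun i => x i ≤ s).card : ℝ) / n

/-- The sample quantile `inf {s : Fₙ(s) ≥ t}` of the data. -/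
def sampleQuantile {n : ℕ} (x : Fin n → ℝ) (t : ℝ) : ℝ := sInf {s : ℝ | t ≤ empiricalCDF x s}

/-- The truncation `x ↦ x I(x ≤ c)`. -/
def trunc (c x : ℝ) : ℝ := if x ≤ c then x else 0

/-- The truncation `x ↦ (x - c) I(x ≤ c)`. -/
def shiftTrunc (c x : ℝ) : ℝ := if x ≤ c then x - c else 0

/-- The generalized Lorenz ordinate `θ(t) = E[X I(X ≤ ψ_t)]` of a law `μ`. -/
def lorenzOrdinate (μ : Measure ℝ) (t : ℝ) : ℝ := ∫ x, trunc (quantile μ t) x ∂μ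

/-- `σ_p² = Var(X I(X ≤ ψ_t))`, for `X` with law `μ`. -/
def sigmaPSq (μ : Measure ℝ) (t : ℝ) : ℝ := Var[trunc (quantile μ t); μ]

/-- `σ_v² = Var((X - ψ_t) I(X ≤ ψ_t))`, for `X` with law `μ`. -/
def sigmaVSq (μ : Measure ℝ) (t : ℝ) : ℝ := Var[shiftTrunc (quantile μ t); μ]

/-- The values `W_i = x_i I(x_i ≤ c) - θ`. For `c = ψ_t` these are the `W_i(t)`, and for `c` the
sample quantile they are the `Ŵ_i(t)`. -/
def centered {n : ℕ} (c θ : ℝ) (x : Fin n → ℝ) : Fin n → ℝ := fun i => trunc c (x i) - θ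

/-- The average `(1/n) ∑ w_i`. -/
def average {n : ℕ} (w : Fin n → ℝ) : ℝ := (∑ i, w i) / n

/-- The empirical likelihood `sup {∏ p_i : p_i ≥ 0, ∑ p_i = 1, ∑ p_i w_i = 0}`. -/
def empLikelihood {N : ℕ} (w : Fin N → ℝ) : ℝ :=
  sSup {L : ℝ | ∃ p : Fin N → ℝ,
    (∀ i, 0 ≤ p i) ∧ ∑ i, p i = 1 ∧ ∑ i, p i * w i = 0 ∧ L = ∏ i, p i}

/-- The empirical log-likelihood ratio `-2 log (L / N^{-N})`, where `N^{-N}` is the unrestricted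
maximum of `∏ p_i`. It equals `2 ∑ log (1 + λ w_i)` for the Lagrange multiplier `λ`, see
`empLogLikRatio_eq`. If the supremum is zero (no weight vector with positive entries satisfies
the constraint) the value is zero, as `Real.log 0 = 0`. -/
def empLogLikRatio {N : ℕ} (w : Fin N → ℝ) : ℝ :=
  -2 * Real.log ((N : ℝ) ^ N * empLikelihood w)

/-- The Lagrange multiplier form: if `∑ w_i / (1 + λ w_i) = 0` with all `1 + λ w_i > 0`, then
the log-likelihood ratio is `2 ∑ log (1 + λ w_i)`. -/
theorem empLogLikRatio_eq {N : ℕ} (hN : 0 < N) (w : Fin N → ℝ) (lam : ℝ)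
    (hpos : ∀ i, 0 < 1 + lam * w i) (hlam : ∑ i, w i / (1 + lam * w i) = 0) :
    empLogLikRatio w = 2 * ∑ i, Real.log (1 + lam * w i) := by
  have hN' : (0 : ℝ) < N := by exact_mod_cast hN
  have hone : ∑ i, 1 / (1 + lam * w i) = N := by
    have h : ∀ i, 1 / (1 + lam * w i) = 1 - lam * (w i / (1 + lam * w i)) := by
      intro i
      have := (hpos i).ne'
      field_simp
      ring
    simp_rw [h, Finset.sum_sub_distrib, ← Finset.mul_sum, hlam]
    simp
  have hprod : (0 : ℝ) < ∏ i, (1 + lam * w i) := Finset.prod_pos fun i _ => hpos i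
  have hmax : IsGreatest {L : ℝ | ∃ p : Fin N → ℝ,
      (∀ i, 0 ≤ p i) ∧ ∑ i, p i = 1 ∧ ∑ i, p i * w i = 0 ∧ L = ∏ i, p i}
      (((N : ℝ) ^ N * ∏ i, (1 + lam * w i))⁻¹) := by
    constructor
    · refine ⟨fun i => (N : ℝ)⁻¹ * (1 / (1 + lam * w i)), ?_, ?_, ?_, ?_⟩
      · intro i
        have := hpos i
        positivity
      · rw [← Finset.mul_sum, hone]
        exact inv_mul_cancel₀ hN'.ne'
      · have h : ∀ i, (N : ℝ)⁻¹ * (1 / (1 + lam * w i)) * w i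
            = (N : ℝ)⁻¹ * (w i / (1 + lam * w i)) := by
          intro i
          ring
        simp_rw [h, ← Finset.mul_sum, hlam, mul_zero]
      · simp [Finset.prod_mul_distrib, mul_comm]
    · rintro L ⟨p, hp0, hp1, hpw, rfl⟩
      have hamgm := Real.geom_mean_le_arith_mean_weighted Finset.univ (fun _ => (N : ℝ)⁻¹)
        (fun i => N * p i * (1 + lam * w i)) (fun i _ => by positivity)
        (by simp [hN'.ne'])
        (fun i _ => mul_nonneg (mul_nonneg hN'.le (hp0 i)) (hpos i).le)
      have hsum : ∑ i, (N : ℝ)⁻¹ * (N * p i * (1 + lam * w i)) = 1 := by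
        have h : ∀ i, (N : ℝ)⁻¹ * (N * p i * (1 + lam * w i)) = p i + lam * (p i * w i) := by
          intro i
          field_simp
        simp_rw [h, Finset.sum_add_distrib, ← Finset.mul_sum, hp1, hpw]
        simp
      have hnn : ∀ i ∈ Finset.univ, 0 ≤ N * p i * (1 + lam * w i) := fun i _ =>
        mul_nonneg (mul_nonneg hN'.le (hp0 i)) (hpos i).le
      rw [hsum, Real.finsetProd_rpow _ _ hnn] at hamgm
      have hle : ∏ i, (N * p i * (1 + lam * w i)) ≤ 1 := by
        by_contra hcon
        exact absurd hamgm (not_le.mpr (Real.one_lt_rpow (not_le.mp hcon) (by positivity)))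
      simp only [Finset.prod_mul_distrib, Finset.prod_const, Finset.card_univ,
        Fintype.card_fin] at hle
      rw [← one_div, le_div_iff₀ (by positivity)]
      linarith
  unfold empLogLikRatio empLikelihood
  rw [hmax.csSup_eq, mul_inv, mul_inv_cancel_left₀ (by positivity), Real.log_inv,
    Real.log_prod (fun i _ => (hpos i).ne')]
  ring

/-- The `n + 1` values `w_1, …, w_n, -a m`: the observations and the pseudo-observation built
from the average `m` and the adjustment level `a`. -/
def adjustedValues {n : ℕ} (w : Fin n → ℝ) (a m : ℝ) : Fin (n + 1) → ℝ := Fin.snoc w (-a * m)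

/-- The adjusted empirical log-likelihood ratio at `θ` of the data `x₁, …, xₙ`, with pseudo-value
`-a m`. The observations are truncated at the sample quantile. -/
def adjustedLogLikRatio {n : ℕ} (t θ a m : ℝ) (x : Fin n → ℝ) : ℝ :=
  empLogLikRatio (adjustedValues (centered (sampleQuantile x t) θ x) a m)

end GenLorenz

end

namespace GenLorenz

/-! ### The quadratic expansion of the empirical log-likelihood ratio -/

/-! Write S and Q for the sum and the sum of squares of the n + 1 adjusted values. Three facts give
the limit.

First, a deterministic one: if max|w| · |S| is small compared with Q, then a Lagrange multiplier
exists and the log-likelihood ratio is S²/Q up to a small relative error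
(`abs_empLogLikRatio_sub_le`). Here S is of order √n, Q of order n and, by square integrability,
max|w| = o(√n) in probability. So the expansion applies with probability tending to one, and the
default value 0 does not affect the limit.

Second, the sample quantile q changes the numerator. With c the population quantile, x I(x ≤ q) = (x
- c) I(x ≤ c) + (x - c) (I(x ≤ q) - I(x ≤ c)) + c I(x ≤ q). After summation, centring and division
by √n, the middle term is at most |q - c| · √n |Fₙ(q) - Fₙ(c)|, which tends to zero because q is
consistent and the second factor is bounded in probability. The last one is c √n (Fₙ(q) - t), which
is O(1/√n) because there are no ties near c. What remains is T, the normalized sum of the shifted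
truncations, with limit N(0, σ_v²). In Q only the few observations between c and q change, so Q/n
still tends to σ_p². Hence the ratio is T²/σ_p² + o(1), and the factor σ_p²/σ_v² makes the limit the
square of a standard normal.

Third, the pseudo-observation -a m is negligible: divided by √n it is -(a/n)(√n m), with a/n → 0 and
√n m bounded in probability.

Convergence in probability is convergence along the filter `inProbability`. Restricted to events on
which T and the normalized count are bounded, the limit argument becomes a deterministic statement
about a filter (`tendsto_adjustedLogLikRatio_sub`). -/

lemma abs_log_one_add_sub_le {x : ℝ} (hx : |x| ≤ 1 / 2) :
    |Real.log (1 + x) - (x - x ^ 2 / 2)| ≤ 2 * |x| * x ^ 2 := by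
  have h := Real.abs_log_sub_add_sum_range_le (x := -x) (by rw [abs_neg]; linarith) 2
  rw [abs_neg] at h
  have e : (∑ i ∈ Finset.range 2, (-x) ^ (i + 1) / ((i : ℝ) + 1)) + Real.log (1 - -x)
      = Real.log (1 + x) - (x - x ^ 2 / 2) := by
    simp [Finset.sum_range_succ]
    ring
  rw [e] at h
  refine h.trans ?_
  rw [div_le_iff₀ (by linarith), pow_succ, sq_abs]
  nlinarith [mul_nonneg (abs_nonneg x) (sq_nonneg x)]

lemma abs_two_mul_sum_log_sub_le {N : ℕ} (w : Fin N → ℝ) {lam κ : ℝ} (hκ : κ ≤ 1 / 2)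
    (h : ∀ i, |lam * w i| ≤ κ) :
    |2 * ∑ i, Real.log (1 + lam * w i) - (2 * lam * ∑ i, w i - lam ^ 2 * ∑ i, w i ^ 2)|
      ≤ 4 * κ * (lam ^ 2 * ∑ i, w i ^ 2) := by
  have e : 2 * ∑ i, Real.log (1 + lam * w i) - (2 * lam * ∑ i, w i - lam ^ 2 * ∑ i, w i ^ 2)
      = ∑ i, 2 * (Real.log (1 + lam * w i) - (lam * w i - (lam * w i) ^ 2 / 2)) := by
    simp only [Finset.mul_sum, ← Finset.sum_sub_distrib]
    exact Finset.sum_congr rfl fun i _ => by ring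
  rw [e, Finset.mul_sum, Finset.mul_sum]
  refine (Finset.abs_sum_le_sum_abs _ _).trans (Finset.sum_le_sum fun i _ => ?_)
  rw [abs_mul, abs_two]
  have h1 := abs_log_one_add_sub_le ((h i).trans hκ)
  have h2 := mul_le_mul_of_nonneg_right (h i) (sq_nonneg (lam * w i))
  calc _ ≤ 2 * (2 * |lam * w i| * (lam * w i) ^ 2) := by gcongr
    _ ≤ 4 * (κ * (lam * w i) ^ 2) := by linarith
    _ = _ := by ring

/-- The score λ ↦ ∑ w / (1 + λ w) equals S at 0 and is approximately S - λ Q nearby. It changes sign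
before twice the approximate root S / Q, so the intermediate value theorem applies. -/
lemma exists_lagrange_multiplier {N : ℕ} (w : Fin N → ℝ) {M κ : ℝ} (hM : ∀ i, |w i| ≤ M)
    (hS : 0 < ∑ i, w i ^ 2) (hκ : κ ≤ 1 / 4) (h : M * |∑ i, w i| ≤ κ * ∑ i, w i ^ 2) :
    ∃ lam, (∀ i, |lam * w i| ≤ 2 * κ) ∧ ∑ i, w i / (1 + lam * w i) = 0 := by
  set S := ∑ i, w i with hSdef
  set Q := ∑ i, w i ^ 2 with hQ
  -- Overshooting by the factor 2 leaves room: between 0 and l every 1 + λ w lies in [1/2, 3/2], so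
  -- ∑ w² / (1 + l w) ≥ Q / 2, enough to reverse the sign of S.
  set l := 2 * S / Q with hl
  have hw : ∀ lam, |lam| ≤ |l| → ∀ i, |lam * w i| ≤ 2 * κ := by
    intro lam hlam i
    have hM0 : 0 ≤ M := (abs_nonneg _).trans (hM i)
    have h1 : |lam * w i| ≤ |l| * M := by
      rw [abs_mul]
      exact mul_le_mul hlam (hM i) (abs_nonneg _) (abs_nonneg _)
    have h2 : |l| * M = 2 * (M * |S| / Q) := by
      rw [hl, abs_div, abs_mul, abs_two, abs_of_pos hS]
      ring
    have h3 : M * |S| / Q ≤ κ := (div_le_iff₀ hS).2 h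
    linarith
  have hpos : ∀ lam, |lam| ≤ |l| → ∀ i, 1 / 2 ≤ 1 + lam * w i := fun lam hlam i => by
    have := (abs_le.1 (hw lam hlam i)).1
    linarith
  have hmem : ∀ lam ∈ Set.uIcc 0 l, |lam| ≤ |l| := by
    intro lam hlam
    have := Set.abs_sub_left_of_mem_uIcc hlam
    simpa using this
  have hcont : ContinuousOn (fun lam => ∑ i, w i / (1 + lam * w i)) (Set.uIcc 0 l) := by
    refine continuousOn_finsetSum _ fun i _ => ?_
    refine ContinuousOn.div (by fun_prop) (by fun_prop) fun lam hlam => ?_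
    have := hpos lam (hmem lam hlam) i
    linarith
  have hend : S * ∑ i, w i / (1 + l * w i) ≤ 0 := by
    have e : ∑ i, w i / (1 + l * w i) = S - l * ∑ i, w i ^ 2 / (1 + l * w i) := by
      rw [hSdef, Finset.mul_sum, ← Finset.sum_sub_distrib]
      refine Finset.sum_congr rfl fun i _ => ?_
      have := hpos l le_rfl i
      have : 1 + l * w i ≠ 0 := by linarith
      rw [eq_sub_iff_add_eq, ← mul_div_assoc, ← add_div, div_eq_iff this]
      ring
    have hq : Q / 2 ≤ ∑ i, w i ^ 2 / (1 + l * w i) := by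
      rw [hQ, Finset.sum_div]
      refine Finset.sum_le_sum fun i _ => ?_
      have := hpos l le_rfl i
      have h2 := (abs_le.1 (hw l le_rfl i)).2
      gcongr
      linarith
    rw [e, hl]
    have : S * (S - 2 * S / Q * ∑ i, w i ^ 2 / (1 + 2 * S / Q * w i))
        = S ^ 2 * (1 - (2 / Q) * ∑ i, w i ^ 2 / (1 + 2 * S / Q * w i)) := by ring
    rw [this]
    refine mul_nonpos_of_nonneg_of_nonpos (sq_nonneg _) ?_
    have : 2 / Q * (Q / 2) = 1 := by field_simp
    have h3 := mul_le_mul_of_nonneg_left hq (show 0 ≤ 2 / Q by positivity)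
    rw [hl] at h3
    linarith
  have hz : (0 : ℝ) ∈ Set.uIcc (∑ i, w i / (1 + 0 * w i)) (∑ i, w i / (1 + l * w i)) := by
    simp only [zero_mul, add_zero, div_one]
    rw [Set.mem_uIcc]
    change S ≤ 0 ∧ _ ∨ _ ∧ 0 ≤ S
    rcases lt_trichotomy S 0 with hs | hs | hs
    · exact Or.inl ⟨hs.le, by nlinarith⟩
    · have : l = 0 := by rw [hl, hs]; simp
      left
      refine ⟨hs.le, ?_⟩
      simp [this, ← hSdef, hs]
    · exact Or.inr ⟨by nlinarith, hs.le⟩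
  obtain ⟨lam, hlam, h0⟩ := intermediate_value_uIcc hcont hz
  exact ⟨lam, hw lam (hmem lam hlam), h0⟩

/-- The log-likelihood ratio is `(∑ w)² / ∑ w²`, up to a small relative error. -/
theorem abs_empLogLikRatio_sub_le {N : ℕ} (w : Fin N → ℝ) {M κ : ℝ} (hM : ∀ i, |w i| ≤ M)
    (hS : 0 < ∑ i, w i ^ 2) (hκ : κ ≤ 1 / 16) (h : M * |∑ i, w i| ≤ κ * ∑ i, w i ^ 2) :
    |empLogLikRatio w - (∑ i, w i) ^ 2 / ∑ i, w i ^ 2|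
      ≤ 16 * κ * ((∑ i, w i) ^ 2 / ∑ i, w i ^ 2) := by
  have hN : 0 < N := by
    rcases Nat.eq_zero_or_pos N with rfl | hN
    · simp at hS
    · exact hN
  have hM0 : 0 ≤ M := (abs_nonneg _).trans (hM ⟨0, hN⟩)
  obtain ⟨lam, hlam, hroot⟩ := exists_lagrange_multiplier w hM hS (by linarith) h
  have hpos : ∀ i, 0 < 1 + lam * w i := fun i => by
    have := (abs_le.1 (hlam i)).1
    linarith
  rw [empLogLikRatio_eq hN w lam hpos hroot]
  set S := ∑ i, w i with hSdef
  set Q := ∑ i, w i ^ 2 with hQ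
  have hκ0 : 0 ≤ κ := by
    by_contra hc
    have h1 : 0 ≤ M * |S| := mul_nonneg hM0 (abs_nonneg _)
    nlinarith
  -- Upper bound from the Taylor expansion at the true multiplier, lower bound from the expansion at
  -- S / Q. No estimate of lam - S / Q is needed.
  have hup := (abs_le.1 (abs_two_mul_sum_log_sub_le w (by linarith) hlam)).2
  have hmu : ∀ i, |S / Q * w i| ≤ κ := by
    intro i
    rw [abs_mul, abs_div, abs_of_pos hS]
    have h1 : |S| / Q * |w i| ≤ |S| / Q * M := by
      gcongr
      exact hM i
    have h2 : |S| / Q * M = M * |S| / Q := by ring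
    exact h1.trans (h2 ▸ (div_le_iff₀ hS).2 h)
  have hlow := (abs_le.1 (abs_two_mul_sum_log_sub_le w (by linarith) hmu)).1
  -- The sum of logarithms is concave in λ and lam is a critical point, hence a maximum.
  have hconc : ∑ i, Real.log (1 + S / Q * w i) ≤ ∑ i, Real.log (1 + lam * w i) := by
    have h1 : ∀ i, Real.log (1 + S / Q * w i)
        ≤ Real.log (1 + lam * w i) + (S / Q - lam) * (w i / (1 + lam * w i)) := by
      intro i
      have hm : 0 < 1 + S / Q * w i := by
        have := (abs_le.1 (hmu i)).1
        linarith
      have h2 := Real.log_le_sub_one_of_pos (div_pos hm (hpos i))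
      rw [Real.log_div hm.ne' (hpos i).ne'] at h2
      have h3 : (1 + S / Q * w i) / (1 + lam * w i) - 1
          = (S / Q - lam) * (w i / (1 + lam * w i)) := by
        have := (hpos i).ne'
        rw [div_sub_one this]
        ring
      linarith
    have h2 := Finset.sum_le_sum fun i (_ : i ∈ Finset.univ) => h1 i
    rw [Finset.sum_add_distrib, ← Finset.mul_sum, hroot, mul_zero, add_zero] at h2
    exact h2
  have hR : 0 ≤ S ^ 2 / Q := by positivity
  have e1 : (S / Q) ^ 2 * Q = S ^ 2 / Q := by field_simp
  have e2 : 2 * (S / Q) * S = 2 * (S ^ 2 / Q) := by ring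
  rw [e1, e2] at hlow
  -- Completing the square bounds the left side by S² / Q / (1 - 8κ) for every lam. Then 1 / (1 -
  -- 8κ) ≤ 1 + 16κ uses κ ≤ 1/16.
  have hquad : 2 * lam * S - lam ^ 2 * Q * (1 - 8 * κ) ≤ S ^ 2 / Q * (1 + 16 * κ) := by
    have hc : 0 < 1 - 8 * κ := by linarith
    have h1 : 2 * lam * S - lam ^ 2 * Q * (1 - 8 * κ) ≤ S ^ 2 / Q / (1 - 8 * κ) := by
      rw [div_div, le_div_iff₀ (by positivity)]
      nlinarith [sq_nonneg (S - lam * Q * (1 - 8 * κ))]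
    refine h1.trans ?_
    rw [div_le_iff₀ hc, mul_assoc]
    refine le_mul_of_one_le_right hR ?_
    nlinarith
  rw [abs_le]
  constructor
  · nlinarith
  · nlinarith

/-! ### Measurability -/

lemma bddAbove_weights {N : ℕ} (w : Fin N → ℝ) : BddAbove {L : ℝ | ∃ p : Fin N → ℝ,
    (∀ i, 0 ≤ p i) ∧ ∑ i, p i = 1 ∧ ∑ i, p i * w i = 0 ∧ L = ∏ i, p i} := by
  refine ⟨1, ?_⟩
  rintro L ⟨p, h0, h1, -, rfl⟩
  refine Finset.prod_le_one (fun i _ => h0 i) fun i _ => ?_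
  rw [← h1]
  exact Finset.single_le_sum (fun j _ => h0 j) (Finset.mem_univ i)

lemma empLikelihood_nonneg {N : ℕ} (w : Fin N → ℝ) : 0 ≤ empLikelihood w := by
  refine Real.sSup_nonneg ?_
  rintro L ⟨p, h0, -, -, rfl⟩
  exact Finset.prod_nonneg fun i _ => h0 i

/-- The projection of a closed set along the compact simplex is closed. -/
lemma isClosed_setOf_exists_weights {N : ℕ} (c : ℝ) : IsClosed {w : Fin N → ℝ |
    ∃ p ∈ stdSimplex ℝ (Fin N), ∑ i, p i * w i = 0 ∧ c ≤ ∏ i, p i} := by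
  have hK : CompactSpace (stdSimplex ℝ (Fin N)) :=
    isCompact_iff_compactSpace.1 (isCompact_stdSimplex ℝ (Fin N))
  have hA : IsClosed {q : stdSimplex ℝ (Fin N) × (Fin N → ℝ) |
      ∑ i, (q.1 : Fin N → ℝ) i * q.2 i = 0 ∧ c ≤ ∏ i, (q.1 : Fin N → ℝ) i} := by
    have hc : ∀ i, Continuous fun q : stdSimplex ℝ (Fin N) × (Fin N → ℝ) =>
        (q.1 : Fin N → ℝ) i := fun i =>
      (continuous_apply i).comp (continuous_subtype_val.comp continuous_fst)
    have hd : ∀ i, Continuous fun q : stdSimplex ℝ (Fin N) × (Fin N → ℝ) => q.2 i := fun i =>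
      (continuous_apply i).comp continuous_snd
    exact (isClosed_eq (continuous_finsetSum _ fun i _ => (hc i).mul (hd i))
      continuous_const).inter (isClosed_le continuous_const (continuous_finsetProd _ fun i _ => hc i))
  have := isClosedMap_snd_of_compactSpace _ hA
  convert this using 1
  ext w
  constructor
  · rintro ⟨p, hp, h⟩
    exact ⟨(⟨p, hp⟩, w), h, rfl⟩
  · rintro ⟨⟨p, w'⟩, h, rfl⟩
    exact ⟨p, p.2, h⟩

lemma measurable_empLikelihood {N : ℕ} :
    Measurable (empLikelihood : (Fin N → ℝ) → ℝ) := by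
  refine measurable_of_Ioi fun c => ?_
  -- The supremum of the empty set is 0, so negative levels are always exceeded, while exceeding a
  -- level c ≥ 0 forces feasible weights to exist.
  rcases lt_or_ge c 0 with hc | hc
  · convert MeasurableSet.univ
    exact Set.eq_univ_of_forall fun w => hc.trans_le (empLikelihood_nonneg w)
  · have : empLikelihood ⁻¹' Set.Ioi c = ⋃ k : ℕ, {w : Fin N → ℝ |
        ∃ p ∈ stdSimplex ℝ (Fin N), ∑ i, p i * w i = 0 ∧ c + 1 / ((k : ℝ) + 1) ≤ ∏ i, p i} := by
      ext w
      simp only [Set.mem_preimage, Set.mem_Ioi, Set.mem_iUnion, Set.mem_ofPred_eq]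
      constructor
      · intro h
        have hne : {L : ℝ | ∃ p : Fin N → ℝ,
            (∀ i, 0 ≤ p i) ∧ ∑ i, p i = 1 ∧ ∑ i, p i * w i = 0 ∧ L = ∏ i, p i}.Nonempty := by
          by_contra hcon
          rw [Set.not_nonempty_iff_eq_empty] at hcon
          rw [empLikelihood, hcon, Real.sSup_empty] at h
          linarith
        obtain ⟨L, ⟨p, h0, h1, h2, rfl⟩, hL⟩ := exists_lt_of_lt_csSup hne h
        obtain ⟨k, hk⟩ := exists_nat_one_div_lt (sub_pos.2 hL)
        exact ⟨k, p, ⟨h0, h1⟩, h2, by linarith⟩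
      · rintro ⟨k, p, ⟨h0, h1⟩, h2, h3⟩
        have hk : (0 : ℝ) < 1 / ((k : ℝ) + 1) := by positivity
        have : ∏ i, p i ≤ empLikelihood w :=
          le_csSup (bddAbove_weights w) ⟨p, h0, h1, h2, rfl⟩
        linarith
    rw [this]
    exact MeasurableSet.iUnion fun k => (isClosed_setOf_exists_weights _).measurableSet

lemma measurable_empLogLikRatio {N : ℕ} :
    Measurable (empLogLikRatio : (Fin N → ℝ) → ℝ) :=
  (Real.measurable_log.comp (measurable_empLikelihood.const_mul _)).const_mul _

lemma measurable_trunc_uncurry : Measurable fun q : ℝ × ℝ => trunc q.1 q.2 :=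
  Measurable.ite (measurableSet_le measurable_snd measurable_fst) measurable_snd measurable_const

lemma measurable_trunc (c : ℝ) : Measurable (trunc c) :=
  measurable_trunc_uncurry.comp measurable_prodMk_left

lemma measurable_shiftTrunc (c : ℝ) : Measurable (shiftTrunc c) :=
  Measurable.ite measurableSet_Iic (measurable_id.sub_const c) measurable_const

lemma empiricalCDF_eq_average {n : ℕ} (x : Fin n → ℝ) (s : ℝ) :
    empiricalCDF x s = (∑ i, if x i ≤ s then (1 : ℝ) else 0) / n := by
  simp [empiricalCDF]

lemma measurable_empiricalCDF {n : ℕ} (s : ℝ) :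
    Measurable fun x : Fin n → ℝ => empiricalCDF x s := by
  simp_rw [empiricalCDF_eq_average]
  refine (Finset.measurable_fun_sum _ fun i _ => ?_).div_const _
  exact Measurable.ite (measurableSet_le (measurable_pi_apply i) measurable_const)
    measurable_const measurable_const

end GenLorenz

namespace GenLorenz

/-! ### The sample quantile -/

lemma empiricalCDF_mono {n : ℕ} (x : Fin n → ℝ) : Monotone (empiricalCDF x) := by
  intro s t hst
  unfold empiricalCDF
  gcongr

lemma empiricalCDF_eventually_nhdsGE {n : ℕ} (x : Fin n → ℝ) (c : ℝ) :
    ∀ᶠ s in 𝓝[≥] c, empiricalCDF x s = empiricalCDF x c := by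
  have h : ∀ i, ∀ᶠ s in 𝓝[≥] c, (x i ≤ s ↔ x i ≤ c) := by
    intro i
    rcases le_or_gt (x i) c with hi | hi
    · filter_upwards [self_mem_nhdsWithin] with s (hs : c ≤ s)
      exact ⟨fun _ => hi, fun _ => hi.trans hs⟩
    · filter_upwards [nhdsWithin_le_nhds (Iio_mem_nhds hi)] with s hs
      exact ⟨fun h => absurd hs (not_lt.2 h), fun h => absurd hi (not_lt.2 h)⟩
  filter_upwards [eventually_all.2 h] with s hs
  simp only [empiricalCDF, hs]

lemma empiricalCDF_eventually_nhdsLT {n : ℕ} (x : Fin n → ℝ) (c : ℝ) :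
    ∀ᶠ s in 𝓝[<] c, empiricalCDF x s
      = ((Finset.univ.filter fun i => x i < c).card : ℝ) / n := by
  have h : ∀ i, ∀ᶠ s in 𝓝[<] c, (x i ≤ s ↔ x i < c) := by
    intro i
    rcases lt_or_ge (x i) c with hi | hi
    · filter_upwards [nhdsWithin_le_nhds (Ioi_mem_nhds hi)] with s hs
      exact ⟨fun _ => hi, fun _ => le_of_lt hs⟩
    · filter_upwards [self_mem_nhdsWithin] with s (hs : s < c)
      exact ⟨fun h => h.trans_lt hs, fun h => absurd hi (not_le.2 h)⟩
  filter_upwards [eventually_all.2 h] with s hs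
  simp only [empiricalCDF, hs]

lemma empiricalCDF_level_nonempty {n : ℕ} (hn : n ≠ 0) (x : Fin n → ℝ) {t : ℝ} (ht : t ≤ 1) :
    {s : ℝ | t ≤ empiricalCDF x s}.Nonempty := by
  have hne : Nonempty (Fin n) := ⟨⟨0, Nat.pos_of_ne_zero hn⟩⟩
  refine ⟨Finset.univ.sup' Finset.univ_nonempty x, ?_⟩
  have : (Finset.univ.filter fun i => x i ≤ Finset.univ.sup' Finset.univ_nonempty x)
      = Finset.univ :=
    Finset.filter_true_of_mem fun i hi => Finset.le_sup' x hi
  have hn' : (n : ℝ) ≠ 0 := by exact_mod_cast hn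
  simp only [Set.mem_ofPred_eq, empiricalCDF, this, Finset.card_univ, Fintype.card_fin,
    div_self hn', ht]

lemma empiricalCDF_level_bddBelow {n : ℕ} (x : Fin n → ℝ) {t : ℝ} (ht : 0 < t) :
    BddBelow {s : ℝ | t ≤ empiricalCDF x s} := by
  obtain ⟨b, hb⟩ := (Set.finite_range x).bddBelow
  refine ⟨b, fun s hs => ?_⟩
  by_contra! hsb
  have : (Finset.univ.filter fun i => x i ≤ s) = ∅ :=
    Finset.filter_false_of_mem fun i _ h => by
      have := hb (Set.mem_range_self i)
      linarith
  simp only [Set.mem_ofPred_eq, empiricalCDF, this] at hs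
  simp at hs
  linarith

/-- The infimum is attained because Fₙ is a right-continuous step function. -/
lemma le_empiricalCDF_sampleQuantile {n : ℕ} (hn : n ≠ 0) (x : Fin n → ℝ) {t : ℝ} (ht : t ≤ 1) :
    t ≤ empiricalCDF x (sampleQuantile x t) := by
  by_contra! hlt
  have h := empiricalCDF_eventually_nhdsGE x (sampleQuantile x t)
  obtain ⟨u, hu, hsub⟩ := mem_nhdsGE_iff_exists_Ico_subset.1 h
  obtain ⟨s, hs, hsu⟩ := exists_lt_of_csInf_lt (empiricalCDF_level_nonempty hn x ht) hu
  have : empiricalCDF x s ≤ empiricalCDF x (sampleQuantile x t) := by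
    rcases le_total s (sampleQuantile x t) with h1 | h1
    · exact empiricalCDF_mono x h1
    · exact (hsub ⟨h1, hsu⟩).le
  exact absurd hs (not_le.2 (this.trans_lt hlt))

/-- Turns events about the random quantile into events about Fₙ at a fixed point, where the law of
large numbers applies. It also gives measurability. -/
lemma sampleQuantile_le_iff {n : ℕ} (hn : n ≠ 0) (x : Fin n → ℝ) {t : ℝ}
    (ht : t ∈ Set.Ioo (0 : ℝ) 1) (s : ℝ) :
    sampleQuantile x t ≤ s ↔ t ≤ empiricalCDF x s :=
  ⟨fun h => (le_empiricalCDF_sampleQuantile hn x ht.2.le).trans (empiricalCDF_mono x h),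
    fun h => csInf_le (empiricalCDF_level_bddBelow x ht.1) h⟩

lemma card_lt_sampleQuantile_div_le {n : ℕ} (hn : n ≠ 0) (x : Fin n → ℝ) {t : ℝ}
    (ht : t ∈ Set.Ioo (0 : ℝ) 1) :
    ((Finset.univ.filter fun i => x i < sampleQuantile x t).card : ℝ) / n ≤ t := by
  obtain ⟨s, hs, hlt⟩ := ((empiricalCDF_eventually_nhdsLT x (sampleQuantile x t)).and
    self_mem_nhdsWithin).exists
  rw [← hs]
  by_contra! h
  exact absurd ((sampleQuantile_le_iff hn x ht s).2 h.le) (not_le.2 hlt)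

/-- Without ties at the sample quantile, `Fₙ` takes there the value `t` up to `1 / n`. -/
lemma abs_empiricalCDF_sampleQuantile_sub_le {n : ℕ} (hn : n ≠ 0) (x : Fin n → ℝ) {t : ℝ}
    (ht : t ∈ Set.Ioo (0 : ℝ) 1)
    (hties : ∀ i j, x i = sampleQuantile x t → x j = sampleQuantile x t → i = j) :
    |empiricalCDF x (sampleQuantile x t) - t| ≤ 1 / n := by
  set q := sampleQuantile x t with hq
  have h1 := le_empiricalCDF_sampleQuantile hn x ht.2.le
  have h2 := card_lt_sampleQuantile_div_le hn x ht
  rw [← hq] at h1 h2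
  have hcard : (Finset.univ.filter fun i => x i ≤ q).card
      ≤ (Finset.univ.filter fun i => x i < q).card + 1 := by
    have hsub : (Finset.univ.filter fun i => x i ≤ q)
        ⊆ (Finset.univ.filter fun i => x i < q) ∪ (Finset.univ.filter fun i => x i = q) := by
      intro i
      simp only [Finset.mem_filter, Finset.mem_univ, true_and, Finset.mem_union]
      exact lt_or_eq_of_le
    have hone : (Finset.univ.filter fun i => x i = q).card ≤ 1 :=
      Finset.card_le_one.2 fun i hi j hj =>
        hties i j (Finset.mem_filter.1 hi).2 (Finset.mem_filter.1 hj).2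
    exact (Finset.card_le_card hsub).trans ((Finset.card_union_le _ _).trans (by omega))
  have h3 : empiricalCDF x q
      ≤ ((Finset.univ.filter fun i => x i < q).card : ℝ) / n + 1 / n := by
    rw [← add_div, empiricalCDF]
    gcongr
    exact_mod_cast hcard
  rw [abs_le]
  have : (0 : ℝ) ≤ 1 / n := by positivity
  constructor <;> linarith

lemma measurable_sampleQuantile {n : ℕ} {t : ℝ} (ht : t ∈ Set.Ioo (0 : ℝ) 1) :
    Measurable fun x : Fin n → ℝ => sampleQuantile x t := by
  rcases eq_or_ne n 0 with rfl | hn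
  · exact Subsingleton.measurable
  · refine measurable_of_Iic fun s => ?_
    have : (fun x : Fin n → ℝ => sampleQuantile x t) ⁻¹' Set.Iic s
        = {x | t ≤ empiricalCDF x s} := by
      ext x
      exact sampleQuantile_le_iff hn x ht s
    rw [this]
    exact measurableSet_le measurable_const (measurable_empiricalCDF s)

lemma measurable_centered {n : ℕ} (θ : ℝ) :
    Measurable fun q : ℝ × (Fin n → ℝ) => centered q.1 θ q.2 :=
  measurable_pi_iff.2 fun i => (measurable_trunc_uncurry.comp
    (measurable_fst.prodMk ((measurable_pi_apply i).comp measurable_snd))).sub_const θ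

lemma measurable_average {n : ℕ} : Measurable (average : (Fin n → ℝ) → ℝ) :=
  (Finset.measurable_fun_sum _ fun i _ => measurable_pi_apply i).div_const _

lemma measurable_adjustedLogLikRatio {n : ℕ} {t : ℝ} (ht : t ∈ Set.Ioo (0 : ℝ) 1) (θ : ℝ) :
    Measurable fun q : ℝ × ℝ × (Fin n → ℝ) => adjustedLogLikRatio t θ q.1 q.2.1 q.2.2 := by
  refine measurable_empLogLikRatio.comp (measurable_pi_iff.2 fun i => ?_)
  have hx : Measurable fun q : ℝ × ℝ × (Fin n → ℝ) => q.2.2 := measurable_snd.comp measurable_snd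
  refine Fin.lastCases ?_ (fun j => ?_) i
  · simp only [adjustedValues, Fin.snoc_last]
    exact measurable_fst.neg.mul (measurable_fst.comp measurable_snd)
  · simp only [adjustedValues, Fin.snoc_castSucc]
    exact (measurable_pi_apply j).comp ((measurable_centered θ).comp
      (((measurable_sampleQuantile ht).comp hx).prodMk hx))

end GenLorenz

namespace GenLorenz

/-! ### Convergence in probability as convergence along a filter -/

/-- The filter on `ℕ × Ω` of the events whose probability tends to one. Convergence along this
filter is convergence in probability. -/
def inProbability {Ω : Type*} [MeasurableSpace Ω] (P : Measure Ω) : Filter (ℕ × Ω) where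
  sets := {A | Tendsto (fun n => P {ω | (n, ω) ∉ A}) atTop (𝓝 0)}
  univ_sets := by simp
  sets_of_superset {A B} hA hAB := tendsto_of_tendsto_of_tendsto_of_le_of_le tendsto_const_nhds hA
    (fun _ => zero_le) fun n => measure_mono fun ω hω h => hω (hAB h)
  inter_sets {A B} hA hB := by
    have h := Tendsto.add hA hB
    rw [add_zero] at h
    refine tendsto_of_tendsto_of_tendsto_of_le_of_le tendsto_const_nhds h (fun _ => zero_le)
      fun n => ?_
    refine (measure_mono fun ω hω => ?_).trans (measure_union_le _ _)
    by_cases hA : (n, ω) ∈ A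
    · exact Or.inr fun hB => hω ⟨hA, hB⟩
    · exact Or.inl hA

variable {Ω : Type*} [MeasurableSpace Ω] {P : Measure Ω}

lemma eventually_inProbability {Q : ℕ × Ω → Prop} :
    (∀ᶠ p in inProbability P, Q p) ↔ Tendsto (fun n => P {ω | ¬ Q (n, ω)}) atTop (𝓝 0) := Iff.rfl

lemma tendsto_inProbability_iff {f : ℕ → Ω → ℝ} {c : ℝ} :
    Tendsto (fun p : ℕ × Ω => f p.1 p.2) (inProbability P) (𝓝 c)
      ↔ TendstoInMeasure P f atTop (fun _ => c) := by
  rw [tendstoInMeasure_iff_dist, Metric.tendsto_nhds]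
  simp only [eventually_inProbability, not_lt]

lemma tendsto_fst_inProbability : Tendsto Prod.fst (inProbability P) atTop := by
  intro A hA
  refine eventually_inProbability.2 (tendsto_const_nhds.congr' ?_)
  filter_upwards [hA] with n hn
  simp [show n ∈ A from hn]

lemma tendsto_nat_inProbability :
    Tendsto (fun p : ℕ × Ω => (p.1 : ℝ)) (inProbability P) atTop :=
  tendsto_natCast_atTop_atTop.comp tendsto_fst_inProbability

lemma eventually_inProbability_of_ae {Q : ℕ × Ω → Prop} (h : ∀ᵐ ω ∂P, ∀ n, Q (n, ω)) :
    ∀ᶠ p in inProbability P, Q p := by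
  refine eventually_inProbability.2 (tendsto_const_nhds.congr fun n => ?_)
  symm
  exact ae_iff.1 (h.mono fun ω hω => hω n)

/-- Boundedness in probability, uniformly in the index. -/
def BoundedInProbability (P : Measure Ω) (T : ℕ → Ω → ℝ) : Prop :=
  ∀ δ : ENNReal, 0 < δ → ∃ K, ∀ n, P {ω | K < |T n ω|} ≤ δ

/-- To prove convergence in probability, one may restrict to the event that two sequences which
are bounded in probability are bounded by an arbitrary constant. -/
lemma tendsto_inProbability_of_bounded {T U : ℕ → Ω → ℝ} (hT : BoundedInProbability P T)
    (hU : BoundedInProbability P U) {Y : ℕ × Ω → ℝ} {c : ℝ}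
    (h : ∀ K, Tendsto Y
      (inProbability P ⊓ 𝓟 {p | |T p.1 p.2| ≤ K ∧ |U p.1 p.2| ≤ K}) (𝓝 c)) :
    Tendsto Y (inProbability P) (𝓝 c) := by
  intro A hA
  change ∀ᶠ p in inProbability P, Y p ∈ A
  rw [eventually_inProbability, ENNReal.tendsto_atTop_zero]
  intro ε hε
  have hε3 : 0 < ε / 3 := ENNReal.div_pos hε.ne' (by simp)
  obtain ⟨K₁, hK₁⟩ := hT _ hε3
  obtain ⟨K₂, hK₂⟩ := hU _ hε3
  have h1 : ∀ᶠ p in inProbability P, |T p.1 p.2| ≤ max K₁ K₂ ∧ |U p.1 p.2| ≤ max K₁ K₂ →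
    Y p ∈ A := eventually_inf_principal.1 (h (max K₁ K₂) hA)
  obtain ⟨N, hN⟩ := ENNReal.tendsto_atTop_zero.1 (eventually_inProbability.1 h1) _ hε3
  refine ⟨N, fun n hn => ?_⟩
  have hsub : {ω | ¬ Y (n, ω) ∈ A} ⊆ {ω | ¬ (|T n ω| ≤ max K₁ K₂ ∧ |U n ω| ≤ max K₁ K₂ →
      Y (n, ω) ∈ A)} ∪ ({ω | K₁ < |T n ω|} ∪ {ω | K₂ < |U n ω|}) := by
    intro ω hω
    by_cases h1 : K₁ < |T n ω|
    · exact Or.inr (Or.inl h1)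
    by_cases h2 : K₂ < |U n ω|
    · exact Or.inr (Or.inr h2)
    · exact Or.inl fun h => hω (h ⟨(not_lt.1 h1).trans (le_max_left _ _),
        (not_lt.1 h2).trans (le_max_right _ _)⟩)
  calc _ ≤ _ := measure_mono hsub
    _ ≤ _ := (measure_union_le _ _).trans (add_le_add_right (measure_union_le _ _) _)
    _ ≤ ε / 3 + (ε / 3 + ε / 3) := add_le_add (hN n hn) (add_le_add (hK₁ n) (hK₂ n))
    _ = ε := by rw [← add_assoc, ENNReal.add_thirds]

/-! ### Averages of independent, identically distributed variables -/

variable {X : ℕ → Ω → ℝ} {μ : Measure ℝ}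

lemma integral_comp_of_identDistrib (hident : ∀ i, IdentDistrib (X i) (X 0) P P)
    (hμ : μ = P.map (X 0)) {g : ℝ → ℝ} (hg : Measurable g) (i : ℕ) :
    ∫ ω, g (X i ω) ∂P = ∫ x, g x ∂μ := by
  rw [hμ, ← (hident i).map_eq, integral_map (hident i).aemeasurable_fst hg.aestronglyMeasurable]

lemma memLp_comp_of_identDistrib (hident : ∀ i, IdentDistrib (X i) (X 0) P P)
    (hμ : μ = P.map (X 0)) {g : ℝ → ℝ} (hg : Measurable g) {q : ENNReal} (h : MemLp g q μ)
    (i : ℕ) : MemLp (fun ω => g (X i ω)) q P := by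
  rw [hμ, ← (hident i).map_eq, memLp_map_measure_iff hg.aestronglyMeasurable
    (hident i).aemeasurable_fst] at h
  exact h

variable [IsProbabilityMeasure P]

/-- The weak law of large numbers. -/
lemma tendsto_average_inProbability (hindep : iIndepFun X P)
    (hident : ∀ i, IdentDistrib (X i) (X 0) P P) (hμ : μ = P.map (X 0)) {g : ℝ → ℝ}
    (hg : Measurable g) (hint : Integrable g μ) :
    Tendsto (fun p : ℕ × Ω => (∑ i : Fin p.1, g (X i p.2)) / p.1) (inProbability P)
      (𝓝 (∫ x, g x ∂μ)) := by
  have hm : ∀ i, AEMeasurable (X i) P := fun i => (hident i).aemeasurable_fst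
  have h0 : Integrable (fun ω => g (X 0 ω)) P := by
    rw [hμ] at hint
    exact hint.comp_aemeasurable (hm 0)
  have h := strong_law_ae_real (fun i ω => g (X i ω)) h0
    (fun i j hij => (hindep.indepFun hij).comp hg hg) (fun i => (hident i).comp hg)
  rw [integral_comp_of_identDistrib hident hμ hg] at h
  have h2 := tendstoInMeasure_of_tendsto_ae (g := fun _ => ∫ x, g x ∂μ) (fun n => by
    refine AEMeasurable.aestronglyMeasurable ?_
    exact (Finset.aemeasurable_fun_sum _ fun i _ => hg.comp_aemeasurable (hm i)).div_const _) h
  simpa only [Finset.sum_range] using tendsto_inProbability_iff.2 h2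

/-- Normalized sums are bounded in probability, by Chebyshev's inequality. -/
lemma boundedInProbability_normalized_sum (hindep : iIndepFun X P)
    (hident : ∀ i, IdentDistrib (X i) (X 0) P P) (hμ : μ = P.map (X 0)) {g : ℝ → ℝ}
    (hg : Measurable g) (hint : MemLp g 2 μ) :
    BoundedInProbability P
      (fun n ω => (√n)⁻¹ * (∑ i : Fin n, g (X i ω) - n * ∫ x, g x ∂μ)) := by
  intro δ hδ
  have hL := memLp_comp_of_identDistrib hident hμ hg hint
  set v := Var[fun ω => g (X 0 ω); P] with hv
  have hlim : Tendsto (fun K : ℝ => ENNReal.ofReal (v / K ^ 2)) atTop (𝓝 0) := by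
    have : Tendsto (fun K : ℝ => v / K ^ 2) atTop (𝓝 0) :=
      tendsto_const_nhds.div_atTop (tendsto_pow_atTop two_ne_zero)
    simpa using ENNReal.tendsto_ofReal this
  obtain ⟨K, hK, hK0⟩ := ((hlim.eventually_le_const hδ).and (eventually_gt_atTop 0)).exists
  refine ⟨K, fun n => ?_⟩
  -- For n = 0 the normalized sum is zero and K > 0 suffices; Chebyshev's inequality below needs √n
  -- > 0.
  rcases Nat.eq_zero_or_pos n with rfl | hn
  · have : {ω : Ω | K < |(√((0 : ℕ) : ℝ))⁻¹ * (∑ i : Fin 0, g (X i ω)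
        - ((0 : ℕ) : ℝ) * ∫ x, g x ∂μ)|} = ∅ := by
      ext ω
      simpa using hK0.le
    rw [this, measure_empty]
    exact zero_le
  have hn' : (0 : ℝ) < n := by exact_mod_cast hn
  have hs : 0 < √(n : ℝ) := Real.sqrt_pos.2 hn'
  have hmean : ∫ ω, (∑ i : Fin n, fun ω => g (X i ω)) ω ∂P = n * ∫ x, g x ∂μ := by
    simp only [Finset.sum_apply]
    rw [integral_finsetSum _ fun (i : Fin n) _ => (hL i).integrable one_le_two]
    simp [integral_comp_of_identDistrib hident hμ hg]
  have hvar : Var[∑ i : Fin n, fun ω => g (X i ω); P] = n * v := by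
    rw [IndepFun.variance_sum (fun (i : Fin n) _ => hL i) fun (i : Fin n) _ (j : Fin n) _ hij =>
      (hindep.indepFun (fun h => hij (Fin.ext h))).comp hg hg]
    have : ∀ i : Fin n, Var[fun ω => g (X i ω); P] = v := fun i =>
      ((hident i).comp hg).variance_eq
    simp [this]
  have hcheb := meas_ge_le_variance_div_sq (μ := P)
    (memLp_finsetSum' Finset.univ fun (i : Fin n) _ => hL i) (mul_pos hK0 hs)
  rw [hmean, hvar, mul_pow, Real.sq_sqrt hn'.le, mul_comm (n : ℝ) v, mul_div_mul_right _ _ hn'.ne'] at hcheb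
  refine le_trans (measure_mono fun ω hω => ?_) (hcheb.trans hK)
  simp only [Set.mem_ofPred_eq, abs_mul, abs_inv, abs_of_pos hs, Finset.sum_apply] at hω ⊢
  rw [inv_mul_eq_div, lt_div_iff₀ hs] at hω
  exact hω.le

/-- The largest of `n` independent copies of a square integrable variable is `o(√n)` in
probability. -/
lemma eventually_abs_le_mul_sqrt (hindep : iIndepFun X P)
    (hident : ∀ i, IdentDistrib (X i) (X 0) P P) (hμ : μ = P.map (X 0))
    (hint : MemLp id 2 μ) {ε : ℝ} (hε : 0 < ε) :
    ∀ᶠ p in inProbability P, ∀ i : Fin p.1, |X i p.2| ≤ ε * √p.1 := by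
  -- Truncation: each X_i² is at most k² plus the sum over all j of the tails g k (X_j). Choosing k
  -- with tail mean below ε²/2, the sum is below n ε²/2 with high probability, and k² ≤ n ε²/2 for
  -- large n.
  let g : ℝ → ℝ → ℝ := fun K x => if K < |x| then x ^ 2 else 0
  have hg : ∀ K, Measurable (g K) := fun K =>
    Measurable.ite (measurableSet_lt measurable_const measurable_id.abs)
      (measurable_id.pow_const 2) measurable_const
  have hsq : Integrable (fun x : ℝ => x ^ 2) μ := hint.integrable_sq
  have hle : ∀ K x, ‖g K x‖ ≤ x ^ 2 := fun K x => by
    simp only [g]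
    split_ifs
    · simp
    · simp [sq_nonneg]
  have hgi : ∀ K, Integrable (g K) μ := fun K =>
    hsq.mono' (hg K).aestronglyMeasurable (Eventually.of_forall (hle K))
  have htail : Tendsto (fun k : ℕ => ∫ x, g k x ∂μ) atTop (𝓝 (∫ _, 0 ∂μ)) := by
    refine tendsto_integral_of_dominated_convergence _ (fun k => (hg k).aestronglyMeasurable) hsq
      (fun k => Eventually.of_forall (hle k)) (Eventually.of_forall fun x => ?_)
    refine tendsto_const_nhds.congr' ?_
    filter_upwards [tendsto_natCast_atTop_atTop.eventually_ge_atTop |x|] with k hk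
    simp [g, not_lt.2 hk]
  rw [integral_zero] at htail
  have hε2 : 0 < ε ^ 2 / 2 := by positivity
  obtain ⟨k, hk⟩ := (htail.eventually_lt_const hε2).exists
  have hlln := tendsto_average_inProbability hindep hident hμ (hg k) (hgi k)
  filter_upwards [hlln.eventually_lt_const hk,
    tendsto_nat_inProbability.eventually_ge_atTop ((k : ℝ) ^ 2 / (ε ^ 2 / 2)),
    tendsto_nat_inProbability.eventually_gt_atTop 0] with p h1 h2 h3 i
  rw [div_lt_iff₀ h3] at h1
  rw [div_le_iff₀ hε2] at h2
  have hnn : ∀ x, 0 ≤ g k x := fun x => by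
    simp only [g]
    split_ifs
    · exact sq_nonneg x
    · exact le_rfl
  have h4 : g k (X i p.2) ≤ ∑ i : Fin p.1, g k (X i p.2) :=
    Finset.single_le_sum (f := fun i : Fin p.1 => g k (X i p.2)) (fun j _ => hnn _)
      (Finset.mem_univ i)
  have h5 : X i p.2 ^ 2 ≤ k ^ 2 + g k (X i p.2) := by
    simp only [g]
    split_ifs with h
    · nlinarith
    · rw [← sq_abs]
      nlinarith [abs_nonneg (X i p.2)]
  refine abs_le_of_sq_le_sq ?_ (by positivity)
  rw [mul_pow, Real.sq_sqrt h3.le]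
  linarith

end GenLorenz

namespace GenLorenz

/-! ### The population quantile -/

section Quantile

variable {μ : Measure ℝ} [IsProbabilityMeasure μ] {t : ℝ}

omit [IsProbabilityMeasure μ] in
lemma cdf_lt_of_lt_quantile (ht : 0 < t) {s : ℝ} (hs : s < quantile μ t) : cdf μ s < t := by
  by_contra! h
  have hb : BddBelow {x : ℝ | t ≤ cdf μ x} := by
    obtain ⟨b, hb⟩ := ((tendsto_cdf_atBot μ).eventually_lt_const ht).exists
    refine ⟨b, fun x hx => ?_⟩
    by_contra! hxb
    have := monotone_cdf μ hxb.le
    have hx' : t ≤ cdf μ x := hx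
    linarith
  exact absurd (csInf_le hb h) (not_le.2 hs)

omit [IsProbabilityMeasure μ] in
lemma cdf_quantile (ht : 0 < t) (hcont : ContinuousAt (cdf μ) (quantile μ t))
    (huniq : ∀ x, quantile μ t < x → t < cdf μ x) : cdf μ (quantile μ t) = t := by
  apply le_antisymm
  · refine le_of_tendsto (hcont.tendsto.mono_left nhdsWithin_le_nhds :
      Tendsto _ (𝓝[<] quantile μ t) _) ?_
    filter_upwards [self_mem_nhdsWithin] with s hs
    exact (cdf_lt_of_lt_quantile ht hs).le
  · refine ge_of_tendsto (hcont.tendsto.mono_left nhdsWithin_le_nhds :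
      Tendsto _ (𝓝[>] quantile μ t) _) ?_
    filter_upwards [self_mem_nhdsWithin] with s hs
    exact (huniq s hs).le

lemma measure_singleton_of_continuousAt_cdf {x : ℝ} (h : ContinuousAt (cdf μ) x) :
    μ {x} = 0 := by
  rw [← measure_cdf μ, StieltjesFunction.measure_singleton,
    leftLim_eq_of_tendsto (h.tendsto.mono_left nhdsWithin_le_nhds), sub_self, ENNReal.ofReal_zero]

lemma integral_ite_le_eq_cdf (s : ℝ) :
    ∫ x, (if x ≤ s then (1 : ℝ) else 0) ∂μ = cdf μ s := by
  have : (fun x : ℝ => if x ≤ s then (1 : ℝ) else 0) = (Set.Iic s).indicator 1 := by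
    ext x
    simp [Set.indicator_apply]
  rw [this, integral_indicator_one measurableSet_Iic, cdf_eq_real]

/-- Otherwise c would be an atom of mass at least t. Left of the quantile this contradicts F(c) < t,
at the quantile it contradicts continuity, and to its right the half-line itself would be null
although it has mass t. -/
lemma measure_Iic_quantile_diff_singleton_ne_zero (ht : 0 < t)
    (hcont : ContinuousAt (cdf μ) (quantile μ t))
    (huniq : ∀ x, quantile μ t < x → t < cdf μ x) (c : ℝ) :
    μ (Set.Iic (quantile μ t) \ {c}) ≠ 0 := by
  intro h
  have hF := cdf_quantile ht hcont huniq
  rw [cdf_eq_real] at hF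
  have hc : ENNReal.ofReal t ≤ μ {c} := by
    rw [← hF, ofReal_measureReal]
    calc _ ≤ μ ((Set.Iic (quantile μ t) \ {c}) ∪ {c}) := measure_mono (by simp)
      _ ≤ _ := measure_union_le _ _
      _ = _ := by rw [h, zero_add]
  have hpos : 0 < ENNReal.ofReal t := ENNReal.ofReal_pos.2 ht
  rcases lt_trichotomy c (quantile μ t) with hlt | heq | hgt
  · have h1 := cdf_lt_of_lt_quantile ht hlt
    have h2 : μ {c} ≤ ENNReal.ofReal (cdf μ c) := by
      rw [ofReal_cdf]
      exact measure_mono (by simp)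
    have h3 := (ENNReal.ofReal_le_ofReal_iff (cdf_nonneg μ c)).1 (hc.trans h2)
    linarith
  · rw [heq, measure_singleton_of_continuousAt_cdf hcont] at hc
    exact absurd hc (not_le.2 hpos)
  · have : Set.Iic (quantile μ t) \ {c} = Set.Iic (quantile μ t) := by
      refine Set.sdiff_singleton_eq_self fun hmem => ?_
      exact absurd hgt (not_lt.2 hmem)
    rw [this] at h
    rw [← hF, ofReal_measureReal, h] at hpos
    exact lt_irrefl _ hpos

/-- A function which vanishes on the right of the quantile, and is injective at the value zero on
its left, has positive variance. -/
lemma variance_pos_of_vanishing (ht : t ∈ Set.Ioo (0 : ℝ) 1)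
    (hcont : ContinuousAt (cdf μ) (quantile μ t))
    (huniq : ∀ x, quantile μ t < x → t < cdf μ x) {g : ℝ → ℝ} (hg : MemLp g 2 μ) {c : ℝ}
    (h0 : ∀ x, quantile μ t < x → g x = 0) (hc : ∀ x ≤ quantile μ t, g x = 0 → x = c) :
    0 < Var[g; μ] := by
  refine lt_of_le_of_ne (variance_nonneg _ _) fun h => ?_
  have hae := ae_eq_integral_of_variance_eq_zero hg h.symm
  -- With zero variance g is a.e. constant. The half-line on the right has mass 1 - t > 0, so the
  -- constant is 0; on the left this would concentrate the mass at c.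
  have hIoi : μ (Set.Ioi (quantile μ t)) ≠ 0 := by
    intro h1
    have h2 : μ (Set.Iic (quantile μ t)) = 1 := by
      rw [← Set.compl_Ioi, prob_compl_eq_one_iff measurableSet_Ioi]
      exact h1
    have h3 := cdf_quantile ht.1 hcont huniq
    rw [cdf_eq_real, measureReal_def, h2, ENNReal.toReal_one] at h3
    linarith [ht.2]
  have hfreq : ∃ᵐ x ∂μ, x ∈ Set.Ioi (quantile μ t) := frequently_ae_mem_iff.2 hIoi
  obtain ⟨x, hx, hx2⟩ := (hfreq.and_eventually hae).exists
  rw [h0 x hx] at hx2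
  have hfreq2 := frequently_ae_mem_iff.2
    (measure_Iic_quantile_diff_singleton_ne_zero ht.1 hcont huniq c)
  obtain ⟨y, hy, hy2⟩ := (hfreq2.and_eventually hae).exists
  exact hy.2 (hc y hy.1 (hy2.trans hx2.symm))

omit [IsProbabilityMeasure μ] in
lemma memLp_trunc (hint : MemLp id 2 μ) (c : ℝ) : MemLp (trunc c) 2 μ :=
  hint.mono (measurable_trunc c).aestronglyMeasurable <| Eventually.of_forall fun x => by
    unfold trunc
    split_ifs <;> simp

lemma memLp_shiftTrunc (hint : MemLp id 2 μ) (c : ℝ) : MemLp (shiftTrunc c) 2 μ :=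
  (hint.sub (memLp_const c)).mono (measurable_shiftTrunc c).aestronglyMeasurable <|
    Eventually.of_forall fun x => by
      unfold shiftTrunc
      split_ifs <;> simp

lemma sigmaPSq_pos (ht : t ∈ Set.Ioo (0 : ℝ) 1) (hcont : ContinuousAt (cdf μ) (quantile μ t))
    (huniq : ∀ x, quantile μ t < x → t < cdf μ x) (hint : MemLp id 2 μ) : 0 < sigmaPSq μ t :=
  variance_pos_of_vanishing ht hcont huniq (memLp_trunc hint _)
    (fun x hx => by simp [trunc, not_le.2 hx]) (c := 0) fun x hx h => by simpa [trunc, hx] using h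

lemma sigmaVSq_pos (ht : t ∈ Set.Ioo (0 : ℝ) 1) (hcont : ContinuousAt (cdf μ) (quantile μ t))
    (huniq : ∀ x, quantile μ t < x → t < cdf μ x) (hint : MemLp id 2 μ) : 0 < sigmaVSq μ t :=
  variance_pos_of_vanishing ht hcont huniq (memLp_shiftTrunc hint _)
    (fun x hx => by simp [shiftTrunc, not_le.2 hx]) (c := quantile μ t)
    fun x hx h => by simpa [shiftTrunc, hx, sub_eq_zero] using h

lemma integral_shiftTrunc_quantile (ht : 0 < t) (hcont : ContinuousAt (cdf μ) (quantile μ t))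
    (huniq : ∀ x, quantile μ t < x → t < cdf μ x) (hint : MemLp id 2 μ) :
    ∫ x, shiftTrunc (quantile μ t) x ∂μ = lorenzOrdinate μ t - quantile μ t * t := by
  have h1 : ∀ x, shiftTrunc (quantile μ t) x = trunc (quantile μ t) x
      - quantile μ t * (if x ≤ quantile μ t then (1 : ℝ) else 0) := fun x => by
    unfold shiftTrunc trunc
    split_ifs <;> simp
  have hi : Integrable (fun x => if x ≤ quantile μ t then (1 : ℝ) else 0) μ := by
    refine Integrable.of_bound (Measurable.ite measurableSet_Iic measurable_const
      measurable_const).aestronglyMeasurable 1 (Eventually.of_forall fun x => ?_)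
    split_ifs <;> simp
  simp_rw [h1]
  rw [integral_sub ((memLp_trunc hint _).integrable one_le_two) (hi.const_mul _),
    integral_const_mul, integral_ite_le_eq_cdf, cdf_quantile ht hcont huniq, lorenzOrdinate]

end Quantile

/-! ### Consistency of the sample quantile -/

section Consistency

variable {Ω : Type*} [MeasurableSpace Ω] {P : Measure Ω} [IsProbabilityMeasure P] {X : ℕ → Ω → ℝ}
  {μ : Measure ℝ} {t : ℝ}

lemma tendsto_empiricalCDF (hindep : iIndepFun X P)
    (hident : ∀ i, IdentDistrib (X i) (X 0) P P) (hμ : μ = P.map (X 0)) (s : ℝ) :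
    Tendsto (fun p : ℕ × Ω => empiricalCDF (fun i : Fin p.1 => X i p.2) s) (inProbability P)
      (𝓝 (cdf μ s)) := by
  have hprob : IsProbabilityMeasure μ :=
    hμ ▸ Measure.isProbabilityMeasure_map (hident 0).aemeasurable_fst
  have hg : Measurable fun x : ℝ => if x ≤ s then (1 : ℝ) else 0 :=
    Measurable.ite measurableSet_Iic measurable_const measurable_const
  have hi : Integrable (fun x => if x ≤ s then (1 : ℝ) else 0) μ := by
    refine Integrable.of_bound hg.aestronglyMeasurable 1 (Eventually.of_forall fun x => ?_)
    split_ifs <;> simp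
  have h := tendsto_average_inProbability hindep hident hμ hg hi
  rw [integral_ite_le_eq_cdf] at h
  exact h.congr fun p => (empiricalCDF_eq_average _ _).symm

omit [IsProbabilityMeasure P] in
lemma eventually_ne_zero_inProbability : ∀ᶠ p in inProbability P, p.1 ≠ 0 :=
  tendsto_fst_inProbability.eventually_ne_atTop 0

lemma tendsto_sampleQuantile (hindep : iIndepFun X P)
    (hident : ∀ i, IdentDistrib (X i) (X 0) P P) (hμ : μ = P.map (X 0))
    (ht : t ∈ Set.Ioo (0 : ℝ) 1) (huniq : ∀ x, quantile μ t < x → t < cdf μ x) :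
    Tendsto (fun p : ℕ × Ω => sampleQuantile (fun i : Fin p.1 => X i p.2) t) (inProbability P)
      (𝓝 (quantile μ t)) := by
  refine tendsto_order.2 ⟨fun s hs => ?_, fun s hs => ?_⟩
  · filter_upwards [(tendsto_empiricalCDF hindep hident hμ s).eventually_lt_const
      (cdf_lt_of_lt_quantile ht.1 hs), eventually_ne_zero_inProbability] with p hp hn
    exact not_le.1 fun h => absurd ((sampleQuantile_le_iff hn _ ht s).1 h) (not_le.2 hp)
  -- The intermediate point r makes the conclusion strict, since Fₙ(r) ≥ t only yields that the
  -- sample quantile is at most r.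
  · obtain ⟨r, hr, hrs⟩ := exists_between hs
    filter_upwards [(tendsto_empiricalCDF hindep hident hμ r).eventually_const_lt (huniq r hr),
      eventually_ne_zero_inProbability] with p hp hn
    exact ((sampleQuantile_le_iff hn _ ht r).2 hp.le).trans_lt hrs

/-- Two independent variables with the same law almost surely do not coincide at a continuity
point of their law. -/
lemma ae_eq_imp_not_mem (hindep : iIndepFun X P)
    (hident : ∀ i, IdentDistrib (X i) (X 0) P P) (hμ : μ = P.map (X 0)) {U : Set ℝ}
    (hU : MeasurableSet U) (hatom : ∀ x ∈ U, μ {x} = 0) {i j : ℕ} (hij : i ≠ j) :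
    ∀ᵐ ω ∂P, X i ω = X j ω → X i ω ∉ U := by
  have hprob : IsProbabilityMeasure μ :=
    hμ ▸ Measure.isProbabilityMeasure_map (hident 0).aemeasurable_fst
  have hm : ∀ k, AEMeasurable (X k) P := fun k => (hident k).aemeasurable_fst
  have hlaw : P.map (fun ω => (X i ω, X j ω)) = μ.prod μ := by
    rw [(indepFun_iff_map_prod_eq_prod_map_map (hm i) (hm j)).1 (hindep.indepFun hij),
      (hident i).map_eq, (hident j).map_eq, ← hμ]
  have hD : MeasurableSet {q : ℝ × ℝ | q.1 = q.2 ∧ q.1 ∈ U} :=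
    (measurableSet_eq_fun measurable_fst measurable_snd).inter (measurable_fst hU)
  have h0 : (μ.prod μ) {q : ℝ × ℝ | q.1 = q.2 ∧ q.1 ∈ U} = 0 := by
    -- By Fubini it suffices that every slice of the diagonal over U, a single point, is null.
    rw [Measure.measure_prod_null hD]
    refine Eventually.of_forall fun x => ?_
    by_cases hx : x ∈ U
    · refine measure_mono_null (fun y hy => ?_) (hatom x hx)
      exact hy.1.symm
    · refine measure_mono_null (fun y hy => ?_) measure_empty
      exact hx hy.2
  rw [← hlaw, Measure.map_apply_of_aemeasurable ((hm i).prodMk (hm j)) hD] at h0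
  rw [ae_iff]
  convert h0 using 2
  ext ω
  simp

/-- By consistency the sample quantile falls into an open set U on which F is continuous, and almost
surely no two observations coincide in U. -/
lemma eventually_abs_empiricalCDF_sampleQuantile_sub_le (hindep : iIndepFun X P)
    (hident : ∀ i, IdentDistrib (X i) (X 0) P P) (hμ : μ = P.map (X 0))
    (ht : t ∈ Set.Ioo (0 : ℝ) 1)
    (hcont : ∀ᶠ x in 𝓝 (quantile μ t), ContinuousAt (cdf μ) x)
    (huniq : ∀ x, quantile μ t < x → t < cdf μ x) :
    ∀ᶠ p in inProbability P, |empiricalCDF (fun i : Fin p.1 => X i p.2)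
      (sampleQuantile (fun i : Fin p.1 => X i p.2) t) - t| ≤ 1 / p.1 := by
  have hprob : IsProbabilityMeasure μ :=
    hμ ▸ Measure.isProbabilityMeasure_map (hident 0).aemeasurable_fst
  obtain ⟨U, hU, hUo, hmem⟩ := eventually_nhds_iff.1 hcont
  have hties : ∀ᵐ ω ∂P, ∀ i j, i ≠ j → X i ω = X j ω → X i ω ∉ U := by
    refine ae_all_iff.2 fun i => ae_all_iff.2 fun j => ?_
    by_cases hij : i = j
    · exact Eventually.of_forall fun ω h => absurd hij h
    · filter_upwards [ae_eq_imp_not_mem hindep hident hμ hUo.measurableSet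
        (fun x hx => measure_singleton_of_continuousAt_cdf (hU x hx)) hij] with ω hω _
      exact hω
  filter_upwards [eventually_inProbability_of_ae
      (Q := fun p : ℕ × Ω => ∀ i j, i ≠ j → X i p.2 = X j p.2 → X i p.2 ∉ U)
      (hties.mono fun ω h _ => h),
    tendsto_sampleQuantile hindep hident hμ ht huniq (hUo.mem_nhds hmem),
    eventually_ne_zero_inProbability] with p h1 h2 hn
  refine abs_empiricalCDF_sampleQuantile_sub_le hn _ ht fun i j hi hj => ?_
  by_contra hij
  refine h1 i j (fun h => hij (Fin.ext h)) (hi.trans hj.symm) ?_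
  rw [hi]
  exact h2

end Consistency

end GenLorenz

namespace GenLorenz

/-! ### Replacing the quantile by the sample quantile -/

/-- The half-lines are nested, so all differences of indicators have the same sign and the absolute
value may be taken outside the sum. -/
lemma sum_abs_ite_sub_ite {n : ℕ} (hn : n ≠ 0) (x : Fin n → ℝ) (c d : ℝ) :
    ∑ i, |(if x i ≤ c then (1 : ℝ) else 0) - if x i ≤ d then 1 else 0|
      = n * |empiricalCDF x c - empiricalCDF x d| := by
  have hn' : (n : ℝ) ≠ 0 := by exact_mod_cast hn
  have e : (n : ℝ) * |empiricalCDF x c - empiricalCDF x d|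
      = |∑ i, ((if x i ≤ c then (1 : ℝ) else 0) - if x i ≤ d then 1 else 0)| := by
    rw [empiricalCDF_eq_average, empiricalCDF_eq_average, ← sub_div, abs_div, Nat.abs_cast,
      mul_div_cancel₀ _ hn', Finset.sum_sub_distrib]
  rw [e]
  rcases le_total c d with h | h
  · rw [← abs_neg, ← Finset.sum_neg_distrib, Finset.abs_sum_of_nonneg']
    · refine Finset.sum_congr rfl fun i _ => ?_
      rw [← abs_neg, abs_of_nonneg]
      split_ifs <;> first | (norm_num; done) | exact absurd (le_trans ‹_› h) ‹_›
    · intro i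
      split_ifs <;> first | (norm_num; done) | exact absurd (le_trans ‹_› h) ‹_›
  · rw [Finset.abs_sum_of_nonneg']
    · refine Finset.sum_congr rfl fun i _ => ?_
      rw [abs_of_nonneg]
      split_ifs <;> first | (norm_num; done) | exact absurd (le_trans ‹_› h) ‹_›
    · intro i
      split_ifs <;> first | (norm_num; done) | exact absurd (le_trans ‹_› h) ‹_›

/-- The normalized sum `n^{-1/2} ∑ {(x_i - c) I(x_i ≤ c) - (θ - c t)}`. -/
noncomputable def normalizedShift {n : ℕ} (c θ t : ℝ) (x : Fin n → ℝ) : ℝ :=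
  (√n)⁻¹ * (∑ i, shiftTrunc c (x i) - n * (θ - c * t))

/-- The normalized sum `n^{-1/2} ∑ {I(x_i ≤ c) - t}`. -/
noncomputable def normalizedCount {n : ℕ} (c t : ℝ) (x : Fin n → ℝ) : ℝ :=
  (√n)⁻¹ * (∑ i, (if x i ≤ c then (1 : ℝ) else 0) - n * t)

lemma normalizedCount_eq {n : ℕ} (hn : n ≠ 0) (c t : ℝ) (x : Fin n → ℝ) :
    normalizedCount c t x = √n * (empiricalCDF x c - t) := by
  have hn' : (0 : ℝ) < n := by exact_mod_cast Nat.pos_of_ne_zero hn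
  have hs := Real.sqrt_pos.2 hn'
  rw [normalizedCount, empiricalCDF_eq_average]
  have : (n : ℝ) = √n * √n := (Real.mul_self_sqrt hn'.le).symm
  rw [inv_mul_eq_div, div_eq_iff hs.ne', mul_right_comm, ← this, mul_sub,
    mul_div_cancel₀ _ hn'.ne']

lemma sqrt_mul_average {n : ℕ} (hn : n ≠ 0) (w : Fin n → ℝ) :
    √n * average w = (√n)⁻¹ * ∑ i, w i := by
  have hn' : (0 : ℝ) < n := by exact_mod_cast Nat.pos_of_ne_zero hn
  have hs := Real.sqrt_pos.2 hn'
  rw [average, inv_mul_eq_div, eq_div_iff hs.ne', mul_right_comm, Real.mul_self_sqrt hn'.le,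
    mul_div_cancel₀ _ hn'.ne']

lemma sqrt_mul_average_centered {n : ℕ} (hn : n ≠ 0) (c θ t : ℝ) (x : Fin n → ℝ) :
    √n * average (centered c θ x) = normalizedShift c θ t x + c * normalizedCount c t x := by
  have e : ∀ i, centered c θ x i
      = shiftTrunc c (x i) + c * (if x i ≤ c then (1 : ℝ) else 0) - θ := fun i => by
    unfold centered trunc shiftTrunc
    split_ifs <;> ring
  rw [sqrt_mul_average hn, normalizedShift, normalizedCount]
  simp_rw [e, Finset.sum_sub_distrib, Finset.sum_add_distrib, ← Finset.mul_sum]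
  simp only [Finset.sum_const, Finset.card_univ, Fintype.card_fin, nsmul_eq_mul]
  ring

/-- This is where the shift by c, and hence σ_v², enters. The indicators differ only for
observations between c and q, where |x_i - c| ≤ |q - c|; the remaining term involves only Fₙ(q) - t.
-/
lemma abs_sqrt_mul_average_centered_sub_le {n : ℕ} (hn : n ≠ 0) (c q θ t : ℝ) (x : Fin n → ℝ) :
    |√n * average (centered q θ x) - normalizedShift c θ t x|
      ≤ |q - c| * (√n * |empiricalCDF x q - empiricalCDF x c|)
        + |c| * (√n * |empiricalCDF x q - t|) := by
  have hn' : (0 : ℝ) < n := by exact_mod_cast Nat.pos_of_ne_zero hn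
  have hs := Real.sqrt_pos.2 hn'
  have e : ∀ i, centered q θ x i = shiftTrunc c (x i)
      + (x i - c) * ((if x i ≤ q then (1 : ℝ) else 0) - if x i ≤ c then 1 else 0)
      + c * (if x i ≤ q then (1 : ℝ) else 0) - θ := fun i => by
    unfold centered trunc shiftTrunc
    split_ifs <;> ring
  have h1 : √n * average (centered q θ x) - normalizedShift c θ t x
      = (√n)⁻¹ * ∑ i, (x i - c) * ((if x i ≤ q then (1 : ℝ) else 0) - if x i ≤ c then 1 else 0)
        + c * (√n * (empiricalCDF x q - t)) := by
    rw [← normalizedCount_eq hn, sqrt_mul_average hn, normalizedShift, normalizedCount]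
    simp_rw [e, Finset.sum_sub_distrib, Finset.sum_add_distrib, ← Finset.mul_sum]
    simp only [Finset.sum_const, Finset.card_univ, Fintype.card_fin, nsmul_eq_mul]
    ring
  have h2 : |∑ i, (x i - c) * ((if x i ≤ q then (1 : ℝ) else 0) - if x i ≤ c then 1 else 0)|
      ≤ |q - c| * (n * |empiricalCDF x q - empiricalCDF x c|) := by
    rw [← sum_abs_ite_sub_ite hn, Finset.mul_sum]
    refine (Finset.abs_sum_le_sum_abs _ _).trans (Finset.sum_le_sum fun i _ => ?_)
    rw [abs_mul]
    by_cases h3 : x i ≤ q <;> by_cases h4 : x i ≤ c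
    · simp [h3, h4]
    · simp only [h3, h4, if_true, if_false, sub_zero, abs_one, mul_one]
      rw [abs_of_pos (by linarith), abs_of_pos (by linarith)]
      linarith
    · simp only [h3, h4, if_true, if_false, zero_sub, abs_neg, abs_one, mul_one]
      rw [abs_of_nonpos (by linarith), abs_of_neg (by linarith)]
      linarith
    · simp [h3, h4]
  rw [h1]
  refine (abs_add_le _ _).trans (add_le_add ?_ ?_)
  · rw [abs_mul, abs_inv, abs_of_pos hs, inv_mul_le_iff₀ hs]
    refine h2.trans_eq ?_
    nth_rewrite 1 [← Real.mul_self_sqrt hn'.le]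
    ring
  · rw [abs_mul, abs_mul, abs_of_pos hs]

/-- Only observations between c and q change, and for these both squares are bounded by the
constant. -/
lemma abs_sum_centered_sq_sub_le {n : ℕ} (hn : n ≠ 0) (c q θ : ℝ) (x : Fin n → ℝ) :
    |∑ i, centered q θ x i ^ 2 - ∑ i, centered c θ x i ^ 2|
      ≤ (|c| + |q - c| + |θ|) ^ 2 * (n * |empiricalCDF x q - empiricalCDF x c|) := by
  rw [← sum_abs_ite_sub_ite hn, ← Finset.sum_sub_distrib, Finset.mul_sum]
  refine (Finset.abs_sum_le_sum_abs _ _).trans (Finset.sum_le_sum fun i _ => ?_)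
  have key : |x i - c| ≤ |q - c| →
      |(x i - θ) ^ 2 - (0 - θ) ^ 2| ≤ (|c| + |q - c| + |θ|) ^ 2 := by
    intro h
    have h1 : |x i| ≤ |c| + |q - c| := by
      have := abs_add_le (x i - c) c
      rw [sub_add_cancel] at this
      linarith
    have h2 : |x i - θ| ≤ |c| + |q - c| + |θ| := (abs_sub _ _).trans (by linarith)
    have h3 : |0 - θ| ≤ |c| + |q - c| + |θ| := by
      rw [zero_sub, abs_neg]
      linarith [abs_nonneg c, abs_nonneg (q - c)]
    refine abs_sub_le_of_nonneg_of_le (sq_nonneg _) ?_ (sq_nonneg _) ?_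
    · rw [← sq_abs (x i - θ)]
      gcongr
    · rw [← sq_abs (0 - θ)]
      gcongr
  unfold centered trunc
  by_cases h3 : x i ≤ q <;> by_cases h4 : x i ≤ c
  · simp [h3, h4]
  · simp only [h3, h4, if_true, if_false, sub_zero, abs_one, mul_one]
    refine key ?_
    rw [abs_of_pos (by linarith), abs_of_pos (by linarith)]
    linarith
  · simp only [h3, h4, if_true, if_false]
    rw [zero_sub (1 : ℝ), abs_neg (1 : ℝ), abs_one, mul_one, abs_sub_comm]
    refine key ?_
    rw [abs_of_nonpos (by linarith), abs_of_neg (by linarith)]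
    linarith
  · simp [h3, h4]

lemma sum_adjustedValues {n : ℕ} (w : Fin n → ℝ) (a m : ℝ) :
    ∑ i, adjustedValues w a m i = ∑ i, w i - a * m := by
  simp [adjustedValues, Fin.sum_univ_castSucc, sub_eq_add_neg]

lemma sum_adjustedValues_sq {n : ℕ} (w : Fin n → ℝ) (a m : ℝ) :
    ∑ i, adjustedValues w a m i ^ 2 = ∑ i, w i ^ 2 + (a * m) ^ 2 := by
  simp [adjustedValues, Fin.sum_univ_castSucc]

/-! ### The limit of the adjusted log-likelihood ratio -/

lemma tendsto_zero_mul_of_eventually_abs_le {α : Type*} {L : Filter α} {f g : α → ℝ} {K : ℝ}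
    (hf : Tendsto f L (𝓝 0)) (hg : ∀ᶠ p in L, |g p| ≤ K) :
    Tendsto (fun p => f p * g p) L (𝓝 0) := by
  have h : Tendsto (fun p => |f p| * K) L (𝓝 0) := by simpa using hf.abs.mul_const K
  refine squeeze_zero_norm' ?_ h
  filter_upwards [hg] with p hp
  rw [norm_mul, Real.norm_eq_abs, Real.norm_eq_abs]
  exact mul_le_mul_of_nonneg_left hp (abs_nonneg _)

section Limit

variable {α : Type*} {L : Filter α} {n : α → ℕ} {x : (p : α) → Fin (n p) → ℝ} {a m q : α → ℝ}
  {c θ t b K K' : ℝ}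

lemma eventually_sqrt_mul_abs_empiricalCDF_sub_le (hn : Tendsto (fun p => (n p : ℝ)) L atTop)
    (hF : ∀ᶠ p in L, |empiricalCDF (x p) (q p) - t| ≤ 1 / n p)
    (hU : ∀ᶠ p in L, |normalizedCount c t (x p)| ≤ K) :
    ∀ᶠ p in L, √(n p) * |empiricalCDF (x p) (q p) - t| ≤ (√(n p))⁻¹ ∧
      √(n p) * |empiricalCDF (x p) (q p) - empiricalCDF (x p) c| ≤ 1 + K := by
  filter_upwards [hF, hU, hn.eventually_ge_atTop 1] with p h1 h2 h3
  have hs : 1 ≤ √(n p : ℝ) := Real.one_le_sqrt.2 h3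
  have hs0 : 0 < √(n p : ℝ) := by linarith
  have hn0 : n p ≠ 0 := by
    intro h
    rw [h] at h3
    norm_num at h3
  rw [normalizedCount_eq hn0, abs_mul, abs_of_pos hs0] at h2
  have h4 : √(n p) * |empiricalCDF (x p) (q p) - t| ≤ (√(n p))⁻¹ := by
    have := mul_le_mul_of_nonneg_left h1 hs0.le
    refine this.trans_eq ?_
    rw [mul_one_div, Real.sqrt_div_self]
  refine ⟨h4, ?_⟩
  have h5 := abs_sub_le (empiricalCDF (x p) (q p)) t (empiricalCDF (x p) c)
  rw [abs_sub_comm t] at h5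
  have h6 := mul_le_mul_of_nonneg_left h5 hs0.le
  have h7 : (√(n p : ℝ))⁻¹ ≤ 1 := inv_le_one_of_one_le₀ hs
  linarith

lemma tendsto_sqrt_mul_average_sub (hn : Tendsto (fun p => (n p : ℝ)) L atTop)
    (hq : Tendsto q L (𝓝 c))
    (hF : ∀ᶠ p in L, |empiricalCDF (x p) (q p) - t| ≤ 1 / n p)
    (hU : ∀ᶠ p in L, |normalizedCount c t (x p)| ≤ K) :
    Tendsto (fun p => √(n p) * average (centered (q p) θ (x p)) - normalizedShift c θ t (x p)) L
      (𝓝 0) := by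
  have hinv : Tendsto (fun p => (√(n p : ℝ))⁻¹) L (𝓝 0) :=
    tendsto_inv_atTop_zero.comp (Real.tendsto_sqrt_atTop.comp hn)
  have hq0 : Tendsto (fun p => |q p - c|) L (𝓝 0) := by
    simpa using (hq.sub_const c).abs
  have h : Tendsto (fun p => |q p - c| * (1 + K) + |c| * (√(n p : ℝ))⁻¹) L (𝓝 0) := by
    simpa using (hq0.mul_const (1 + K)).add (hinv.const_mul |c|)
  refine squeeze_zero_norm' ?_ h
  filter_upwards [eventually_sqrt_mul_abs_empiricalCDF_sub_le hn hF hU,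
    hn.eventually_gt_atTop 0] with p h1 h2
  refine (abs_sqrt_mul_average_centered_sub_le (by exact_mod_cast h2.ne') _ _ _ t _).trans ?_
  gcongr
  exacts [h1.2, h1.1]

lemma tendsto_sum_centered_sq_div (hn : Tendsto (fun p => (n p : ℝ)) L atTop)
    (hq : Tendsto q L (𝓝 c))
    (hF : ∀ᶠ p in L, |empiricalCDF (x p) (q p) - t| ≤ 1 / n p)
    (hU : ∀ᶠ p in L, |normalizedCount c t (x p)| ≤ K)
    (hW : Tendsto (fun p => (∑ i, centered c θ (x p) i ^ 2) / n p) L (𝓝 b)) :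
    Tendsto (fun p => (∑ i, centered (q p) θ (x p) i ^ 2) / n p) L (𝓝 b) := by
  have hinv : Tendsto (fun p => (√(n p : ℝ))⁻¹) L (𝓝 0) :=
    tendsto_inv_atTop_zero.comp (Real.tendsto_sqrt_atTop.comp hn)
  have hq0 : Tendsto (fun p => |q p - c|) L (𝓝 0) := by
    simpa using (hq.sub_const c).abs
  have h : Tendsto (fun p => (|c| + |q p - c| + |θ|) ^ 2 * ((√(n p : ℝ))⁻¹ * (1 + K))) L
      (𝓝 0) := by
    have := (((hq0.const_add |c|).add_const |θ|).pow 2).mul (hinv.mul_const (1 + K))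
    simpa using this
  have hd : Tendsto (fun p => (∑ i, centered (q p) θ (x p) i ^ 2) / n p
      - (∑ i, centered c θ (x p) i ^ 2) / n p) L (𝓝 0) := by
    refine squeeze_zero_norm' ?_ h
    filter_upwards [eventually_sqrt_mul_abs_empiricalCDF_sub_le hn hF hU,
      hn.eventually_gt_atTop 0] with p h1 h2
    have hs0 := Real.sqrt_pos.2 h2
    rw [← sub_div, norm_div, Real.norm_eq_abs, Real.norm_of_nonneg h2.le, div_le_iff₀ h2]
    refine (abs_sum_centered_sq_sub_le (by exact_mod_cast h2.ne') _ _ _ _).trans ?_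
    rw [mul_assoc]
    refine mul_le_mul_of_nonneg_left ?_ (sq_nonneg _)
    have h3 : (√(n p : ℝ))⁻¹ * (1 + K) * n p = √(n p) * (1 + K) := by
      rw [mul_right_comm, inv_mul_eq_div, Real.div_sqrt]
    rw [h3]
    calc _ = √(n p) * (√(n p) * |empiricalCDF (x p) (q p) - empiricalCDF (x p) c|) := by
          rw [← mul_assoc, Real.mul_self_sqrt h2.le]
      _ ≤ _ := by
          gcongr
          exact h1.2
  simpa using hd.add hW

lemma abs_adjustedValues_le {N : ℕ} {y : Fin N → ℝ} {c θ a m M : ℝ} (hy : ∀ i, |y i| ≤ M / 2)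
    (hθ : |θ| ≤ M / 2) (hm : |a * m| ≤ M) (i : Fin (N + 1)) :
    |adjustedValues (centered c θ y) a m i| ≤ M := by
  refine Fin.lastCases ?_ (fun j => ?_) i
  · simpa [adjustedValues] using hm
  · simp only [adjustedValues, Fin.snoc_castSucc, centered]
    refine (abs_sub _ _).trans ?_
    have : |trunc c (y j)| ≤ |y j| := by
      unfold trunc
      split_ifs <;> simp
    linarith [hy j]

/-- The adjusted log-likelihood ratio behaves like the squared normalized sum, divided by the
limit `b` of the mean squares. -/
theorem tendsto_adjustedLogLikRatio_sub (hb : 0 < b)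
    (hn : Tendsto (fun p => (n p : ℝ)) L atTop)
    (hq : Tendsto (fun p => sampleQuantile (x p) t) L (𝓝 c))
    (hF : ∀ᶠ p in L, |empiricalCDF (x p) (sampleQuantile (x p) t) - t| ≤ 1 / n p)
    (hW : Tendsto (fun p => (∑ i, centered c θ (x p) i ^ 2) / n p) L (𝓝 b))
    (hmax : ∀ ε > 0, ∀ᶠ p in L, ∀ i, |x p i| ≤ ε * √(n p))
    (ha : Tendsto (fun p => a p / n p) L (𝓝 0))
    (hT : ∀ᶠ p in L, |normalizedShift c θ t (x p)| ≤ K)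
    (hU : ∀ᶠ p in L, |normalizedCount c t (x p)| ≤ K)
    (hm : ∀ᶠ p in L, |√(n p) * m p| ≤ K') :
    Tendsto (fun p => adjustedLogLikRatio t θ (a p) (m p) (x p)
      - normalizedShift c θ t (x p) ^ 2 / b) L (𝓝 0) := by
  -- A proper filter is needed to deduce 0 ≤ K from the eventual bound on T.
  rcases L.eq_or_neBot with rfl | hL
  · exact tendsto_bot
  have hK : 0 ≤ K := by
    obtain ⟨p, hp⟩ := hT.exists
    exact (abs_nonneg _).trans hp
  set w := fun p => adjustedValues (centered (sampleQuantile (x p) t) θ (x p)) (a p) (m p) with hw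
  set A := fun p => (√(n p))⁻¹ * ∑ i, w p i with hA
  set B := fun p => (∑ i, w p i ^ 2) / n p with hB
  set T := fun p => normalizedShift c θ t (x p) with hTdef
  have ham : Tendsto (fun p => a p / n p * (√(n p) * m p)) L (𝓝 0) :=
    tendsto_zero_mul_of_eventually_abs_le ha hm
  have hame : ∀ᶠ p in L, a p / n p * (√(n p) * m p) = (√(n p))⁻¹ * (a p * m p) := by
    filter_upwards [hn.eventually_gt_atTop 0] with p hp
    have hs := Real.sqrt_pos.2 hp
    rw [inv_mul_eq_div, eq_div_iff hs.ne']
    calc _ = a p * m p * (√(n p) * √(n p) / n p) := by ring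
      _ = _ := by rw [Real.mul_self_sqrt hp.le, div_self hp.ne', mul_one]
  have ham' := ham.congr' hame
  have hAT : Tendsto (fun p => A p - T p) L (𝓝 0) := by
    have h := (tendsto_sqrt_mul_average_sub (θ := θ) hn hq hF hU).sub ham'
    rw [sub_zero] at h
    refine h.congr' ?_
    filter_upwards [hn.eventually_gt_atTop 0] with p hp
    rw [sqrt_mul_average (by exact_mod_cast hp.ne')]
    simp only [hA, hw, sum_adjustedValues, hTdef]
    ring
  have hBb : Tendsto B L (𝓝 b) := by
    have h := (tendsto_sum_centered_sq_div hn hq hF hU hW).add (ham'.pow 2)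
    rw [zero_pow two_ne_zero, add_zero] at h
    refine h.congr' ?_
    filter_upwards [hn.eventually_gt_atTop 0] with p hp
    simp only [hB, hw, sum_adjustedValues_sq]
    rw [mul_pow, inv_pow, Real.sq_sqrt hp.le]
    ring
  have hAK : ∀ᶠ p in L, |A p| ≤ K + 1 := by
    filter_upwards [hT, hAT.abs.eventually_le_const (show |(0 : ℝ)| < 1 by simp)] with p h1 h2
    have := abs_add_le (A p - T p) (T p)
    rw [sub_add_cancel] at this
    linarith
  -- Split as (A - T)(A + T) / B + (1/B - 1/b) T²: each term is a null factor times a bounded one.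
  have hquad : Tendsto (fun p => A p ^ 2 / B p - T p ^ 2 / b) L (𝓝 0) := by
    have hBi := hBb.inv₀ hb.ne'
    have h1 : Tendsto (fun p => (A p - T p) * (B p)⁻¹ * (A p + T p)) L (𝓝 0) := by
      refine tendsto_zero_mul_of_eventually_abs_le (K := K + 1 + K) (by simpa using hAT.mul hBi) ?_
      filter_upwards [hAK, hT] with p h1 h2
      exact (abs_add_le _ _).trans (add_le_add h1 h2)
    have h2 : Tendsto (fun p => ((B p)⁻¹ - b⁻¹) * T p ^ 2) L (𝓝 0) := by
      refine tendsto_zero_mul_of_eventually_abs_le (K := K ^ 2)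
        (by simpa using hBi.sub_const b⁻¹) ?_
      filter_upwards [hT] with p h
      rw [abs_pow]
      exact pow_le_pow_left₀ (abs_nonneg _) h 2
    have h3 := h1.add h2
    rw [add_zero] at h3
    exact h3.congr fun p => by ring
  have hmain : Tendsto (fun p => adjustedLogLikRatio t θ (a p) (m p) (x p) - A p ^ 2 / B p) L
      (𝓝 0) := by
    rw [Metric.tendsto_nhds]
    intro δ hδ
    set D := (K + 1) ^ 2 / (b / 2) with hD
    have hDpos : 0 < D := by positivity
    -- The bound 1/16 is required by the expansion. The other makes the error 16 κ D at most δ / 2,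
    -- where D bounds A² / B.
    set κ := min (1 / 16) (δ / (32 * D)) with hκ
    have hκ0 : 0 < κ := by positivity
    -- Chosen so that ε (K + 1) = κ b / 2: with max|w| ≤ ε √n, |A| ≤ K + 1 and B ≥ b / 2, the
    -- smallness condition of the expansion holds.
    set ε := κ * (b / 2) / (K + 1) with hε
    have hε0 : 0 < ε := by positivity
    have hsq : Tendsto (fun p => √(n p : ℝ)) L atTop := Real.tendsto_sqrt_atTop.comp hn
    filter_upwards [hAK, hBb.eventually_const_le (show b / 2 < b by linarith),
      hmax (ε / 2) (by positivity), hn.eventually_gt_atTop 0,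
      hsq.eventually_ge_atTop (|θ| / (ε / 2)),
      ham'.abs.eventually_le_const (show |(0 : ℝ)| < ε by simpa using hε0)]
      with p h1 h2 h3 h4 h5 h6
    have hs := Real.sqrt_pos.2 h4
    have hbound : ∀ i, |w p i| ≤ ε * √(n p) := by
      refine abs_adjustedValues_le (fun i => (h3 i).trans_eq (by ring)) ?_ ?_
      · rw [div_le_iff₀ (by positivity)] at h5
        linarith
      · rw [abs_mul, abs_inv, abs_of_pos hs, inv_mul_le_iff₀ hs] at h6
        linarith
    have hS1 : ∑ i, w p i = √(n p) * A p := by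
      simp only [hA]
      rw [mul_inv_cancel_left₀ hs.ne']
    have hS2 : ∑ i, w p i ^ 2 = n p * B p := by
      simp only [hB]
      rw [mul_div_cancel₀ _ h4.ne']
    have hBpos : 0 < B p := by linarith
    have hsmall : ε * √(n p) * |∑ i, w p i| ≤ κ * ∑ i, w p i ^ 2 := by
      rw [hS1, hS2, abs_mul, abs_of_pos hs]
      calc ε * √(n p) * (√(n p) * |A p|) = n p * (ε * |A p|) := by
            nth_rewrite 3 [← Real.mul_self_sqrt h4.le]
            ring
        _ ≤ n p * (ε * (K + 1)) := by gcongr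
        _ = n p * (κ * (b / 2)) := by
            rw [hε, div_mul_cancel₀ _ (by positivity)]
        _ ≤ n p * (κ * B p) := by gcongr
        _ = _ := by ring
    have hexp := abs_empLogLikRatio_sub_le (w p) hbound (by rw [hS2]; positivity)
      (min_le_left _ _) hsmall
    have hR : (∑ i, w p i) ^ 2 / ∑ i, w p i ^ 2 = A p ^ 2 / B p := by
      rw [hS1, hS2, mul_pow, Real.sq_sqrt h4.le, mul_div_mul_left _ _ h4.ne']
    rw [hR] at hexp
    have hAB : A p ^ 2 / B p ≤ D := by
      rw [← sq_abs, hD]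
      gcongr
    rw [dist_zero_right, Real.norm_eq_abs]
    calc _ ≤ 16 * κ * (A p ^ 2 / B p) := hexp
      _ ≤ 16 * (δ / (32 * D)) * D := by
          gcongr
          exact min_le_right _ _
      _ = δ / 2 := by field_simp; norm_num
      _ < δ := by linarith
  have := hmain.add hquad
  rw [add_zero] at this
  exact this.congr fun p => by ring

end Limit

end GenLorenz

/-! ### The central limit theorem and the chi-square limit -/

namespace GenLorenz

variable {Ω : Type*} [MeasurableSpace Ω] {P : Measure Ω} [IsProbabilityMeasure P] {X : ℕ → Ω → ℝ}
  {μ : Measure ℝ} {t : ℝ}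

/-- The central limit theorem for the normalized sums, squared. -/
lemma tendstoInDistribution_normalizedShift_sq (hindep : iIndepFun X P)
    (hident : ∀ i, IdentDistrib (X i) (X 0) P P) (hμ : μ = P.map (X 0)) (hint : MemLp id 2 μ)
    (ht : 0 < t) (hcont : ContinuousAt (cdf μ) (quantile μ t))
    (huniq : ∀ x, quantile μ t < x → t < cdf μ x) (hv : 0 < sigmaVSq μ t) :
    TendstoInDistribution (fun (n : ℕ) ω => normalizedShift (quantile μ t) (lorenzOrdinate μ t) t
        (fun i : Fin n => X i ω) ^ 2 / sigmaVSq μ t)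
      atTop (fun z : ℝ => z ^ 2) (fun _ => P) (gaussianReal 0 1) := by
  have hprob : IsProbabilityMeasure μ :=
    hμ ▸ Measure.isProbabilityMeasure_map (hident 0).aemeasurable_fst
  have hg := measurable_shiftTrunc (quantile μ t)
  have hvar : Var[fun ω => shiftTrunc (quantile μ t) (X 0 ω); P] = sigmaVSq μ t := by
    have h := variance_map (X := shiftTrunc (quantile μ t)) (Y := X 0) (μ := P) hg.aemeasurable
      (hident 0).aemeasurable_fst
    rw [← hμ] at h
    exact h.symm
  have hlaw : HasLaw (fun z : ℝ => √(sigmaVSq μ t) * z)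
      (gaussianReal 0 (Var[fun ω => shiftTrunc (quantile μ t) (X 0 ω); P]).toNNReal)
      (gaussianReal 0 1) := by
    have h := gaussianReal_const_mul (HasLaw.id (μ := gaussianReal 0 1)) √(sigmaVSq μ t)
    have hs : NNReal.mk (√(sigmaVSq μ t) ^ 2) (sq_nonneg _) * 1 = (sigmaVSq μ t).toNNReal := by
      ext
      simp [Real.sq_sqrt hv.le, hv.le]
    rw [mul_zero, hs] at h
    rw [hvar]
    exact h
  have hclt := tendstoInDistribution_inv_sqrt_mul_sum_sub (P := P)
    (X := fun i ω => shiftTrunc (quantile μ t) (X i ω)) hlaw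
    (memLp_comp_of_identDistrib hident hμ hg (memLp_shiftTrunc hint _) 0)
    (hindep.comp (fun _ => shiftTrunc (quantile μ t)) fun _ => hg) (fun i => (hident i).comp hg)
  rw [integral_comp_of_identDistrib hident hμ hg, integral_shiftTrunc_quantile ht hcont huniq hint]
    at hclt
  have h := hclt.continuous_comp (g := fun y : ℝ => y ^ 2 / sigmaVSq μ t) (by fun_prop)
  convert h using 1
  · ext n ω
    simp only [normalizedShift, Function.comp_apply, Finset.sum_range]
  · ext z
    simp only [Function.comp_apply]
    rw [mul_pow, Real.sq_sqrt hv.le, mul_div_cancel_left₀ _ hv.ne']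

/-- The limit law for a pseudo-value built from any average `m` of order `n^{-1/2}`. -/
theorem tendstoInDistribution_adjustedLogLikRatio (hindep : iIndepFun X P)
    (hident : ∀ i, IdentDistrib (X i) (X 0) P P) (hμ : μ = P.map (X 0)) (hint : MemLp id 2 μ)
    (ht : t ∈ Set.Ioo (0 : ℝ) 1) (hcont : ∀ᶠ x in 𝓝 (quantile μ t), ContinuousAt (cdf μ) x)
    (huniq : ∀ x, quantile μ t < x → t < cdf μ x) {a m : ℕ → Ω → ℝ}
    (ha_meas : ∀ n, AEMeasurable (a n) P) (hm_meas : ∀ n, AEMeasurable (m n) P)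
    (ha : Tendsto (fun p : ℕ × Ω => a p.1 p.2 / p.1) (inProbability P) (𝓝 0))
    (hm : ∀ K, ∃ K', ∀ᶠ p in inProbability P ⊓ 𝓟 {p : ℕ × Ω |
      |normalizedShift (quantile μ t) (lorenzOrdinate μ t) t (fun i : Fin p.1 => X i p.2)| ≤ K ∧
      |normalizedCount (quantile μ t) t (fun i : Fin p.1 => X i p.2)| ≤ K},
        |√p.1 * m p.1 p.2| ≤ K') :
    TendstoInDistribution
      (fun (n : ℕ) ω => sigmaPSq μ t / sigmaVSq μ t *
        adjustedLogLikRatio t (lorenzOrdinate μ t) (a n ω) (m n ω) (fun i : Fin n => X i ω))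
      atTop (fun z : ℝ => z ^ 2) (fun _ => P) (gaussianReal 0 1) := by
  have hprob : IsProbabilityMeasure μ :=
    hμ ▸ Measure.isProbabilityMeasure_map (hident 0).aemeasurable_fst
  have hc := hcont.self_of_nhds
  have hp := sigmaPSq_pos ht hc huniq hint
  have hv := sigmaVSq_pos ht hc huniq hint
  have hX : ∀ n : ℕ, AEMeasurable (fun ω => fun i : Fin n => X i ω) P := fun n =>
    aemeasurable_pi_iff.2 fun i => (hident i).aemeasurable_fst
  -- Slutsky: it remains to show that the difference from T² / σ_v² tends to zero in probability.
  refine tendstoInDistribution_of_tendstoInMeasure_sub _ _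
    (tendstoInDistribution_normalizedShift_sq hindep hident hμ hint ht.1 hc huniq hv) ?_
    fun n => ?_
  swap
  · exact ((measurable_adjustedLogLikRatio ht _).comp_aemeasurable
      ((ha_meas n).prodMk ((hm_meas n).prodMk (hX n)))).const_mul _
  have hcount : Measurable fun x : ℝ => if x ≤ quantile μ t then (1 : ℝ) else 0 :=
    Measurable.ite measurableSet_Iic measurable_const measurable_const
  have hcountL : MemLp (fun x : ℝ => if x ≤ quantile μ t then (1 : ℝ) else 0) 2 μ :=
    MemLp.of_bound hcount.aestronglyMeasurable 1 <| Eventually.of_forall fun x => by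
      split_ifs <;> simp
  have hT := boundedInProbability_normalized_sum hindep hident hμ
    (measurable_shiftTrunc (quantile μ t)) (memLp_shiftTrunc hint _)
  rw [integral_shiftTrunc_quantile ht.1 hc huniq hint] at hT
  have hU := boundedInProbability_normalized_sum hindep hident hμ hcount hcountL
  rw [integral_ite_le_eq_cdf, cdf_quantile ht.1 hc huniq] at hU
  have hgW : Measurable fun x => (trunc (quantile μ t) x - lorenzOrdinate μ t) ^ 2 :=
    ((measurable_trunc _).sub_const _).pow_const 2
  have hW := tendsto_average_inProbability hindep hident hμ hgW
    ((memLp_trunc hint (quantile μ t)).sub (memLp_const _)).integrable_sq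
  have hWv : ∫ x, (trunc (quantile μ t) x - lorenzOrdinate μ t) ^ 2 ∂μ = sigmaPSq μ t :=
    (variance_eq_integral (measurable_trunc _).aemeasurable).symm
  rw [hWv] at hW
  have hlim : Tendsto (fun p : ℕ × Ω =>
      adjustedLogLikRatio t (lorenzOrdinate μ t) (a p.1 p.2) (m p.1 p.2)
        (fun i : Fin p.1 => X i p.2)
      - normalizedShift (quantile μ t) (lorenzOrdinate μ t) t (fun i : Fin p.1 => X i p.2) ^ 2
        / sigmaPSq μ t) (inProbability P) (𝓝 0) := by
    refine tendsto_inProbability_of_bounded hT hU fun K => ?_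
    obtain ⟨K', hK'⟩ := hm K
    exact tendsto_adjustedLogLikRatio_sub (c := quantile μ t) (θ := lorenzOrdinate μ t) hp
      (tendsto_nat_inProbability.mono_left inf_le_left)
      ((tendsto_sampleQuantile hindep hident hμ ht huniq).mono_left inf_le_left)
      ((eventually_abs_empiricalCDF_sampleQuantile_sub_le hindep hident hμ ht hcont
        huniq).filter_mono inf_le_left)
      (hW.mono_left inf_le_left)
      (fun ε hε => (eventually_abs_le_mul_sqrt hindep hident hμ hint hε).filter_mono inf_le_left)
      (ha.mono_left inf_le_left)
      (eventually_inf_principal.2 (Eventually.of_forall fun p h => h.1))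
      (eventually_inf_principal.2 (Eventually.of_forall fun p h => h.2)) hK'
  have hlim2 := hlim.const_mul (sigmaPSq μ t / sigmaVSq μ t)
  rw [mul_zero] at hlim2
  refine (tendsto_inProbability_iff (c := 0)).1 (hlim2.congr fun p => ?_)
  simp only [Pi.sub_apply]
  field_simp

omit [IsProbabilityMeasure P] in
-- The rate o_p(n^{2/3}) enters only through its consequence a = o_p(n), which suffices for the
-- pseudo-observation to be negligible.
lemma tendsto_div_natCast_of_rpow {a : ℕ → Ω → ℝ}
    (ha : TendstoInMeasure P (fun (n : ℕ) ω => a n ω / (n : ℝ) ^ (2 / 3 : ℝ)) atTop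
      (fun _ => 0)) :
    Tendsto (fun p : ℕ × Ω => a p.1 p.2 / p.1) (inProbability P) (𝓝 0) := by
  refine tendsto_zero_iff_norm_tendsto_zero.2 (squeeze_zero' (Eventually.of_forall fun _ =>
    norm_nonneg _) ?_ (tendsto_zero_iff_norm_tendsto_zero.1 (tendsto_inProbability_iff.2 ha)))
  filter_upwards [tendsto_nat_inProbability.eventually_ge_atTop 1] with p hp
  have hpos : (0 : ℝ) < (p.1 : ℝ) ^ (2 / 3 : ℝ) := Real.rpow_pos_of_pos (by linarith) _
  rw [norm_div, norm_div, Real.norm_of_nonneg hpos.le, Real.norm_of_nonneg (show (0 : ℝ) ≤ p.1 by linarith)]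
  gcongr
  calc (p.1 : ℝ) ^ (2 / 3 : ℝ) ≤ (p.1 : ℝ) ^ (1 : ℝ) :=
        Real.rpow_le_rpow_of_exponent_le hp (by norm_num)
    _ = p.1 := Real.rpow_one _

end GenLorenz

/-- The χ²₁ law is represented as that of z² for standard normal z. -/
theorem theorem2p2 {Ω : Type*} [MeasurableSpace Ω] (P : Measure Ω) [IsProbabilityMeasure P]
    (X : ℕ → Ω → ℝ) (a : ℕ → Ω → ℝ)
    (hindep : iIndepFun X P) (hident : ∀ i, IdentDistrib (X i) (X 0) P P)
    (hmom : MemLp (X 0) 2 P)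
    (μ : Measure ℝ) (hμ : μ = P.map (X 0))
    (t₀ : ℝ) (ht₀ : t₀ ∈ Set.Ioo (0 : ℝ) 1)
    (hcont : ∀ᶠ x in 𝓝 (GenLorenz.quantile μ t₀), ContinuousAt (cdf μ) x)
    (huniq : ∀ x, GenLorenz.quantile μ t₀ < x → t₀ < cdf μ x)
    (ha_meas : ∀ n, AEMeasurable (a n) P)
    (ha : TendstoInMeasure P (fun (n : ℕ) ω => a n ω / (n : ℝ) ^ (2 / 3 : ℝ)) atTop
      (fun _ => 0))
    (θ ψ : ℝ) (hθ : θ = GenLorenz.lorenzOrdinate μ t₀) (hψ : ψ = GenLorenz.quantile μ t₀)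
    (x : (n : ℕ) → Ω → Fin n → ℝ) (hx : ∀ n ω i, x n ω i = X i ω) :
    -- the average in the pseudo-value is taken with the sample quantile
    TendstoInDistribution
      (fun (n : ℕ) ω => GenLorenz.sigmaPSq μ t₀ / GenLorenz.sigmaVSq μ t₀ *
        GenLorenz.adjustedLogLikRatio t₀ θ (a n ω)
          (GenLorenz.average
            (GenLorenz.centered (GenLorenz.sampleQuantile (x n ω) t₀) θ (x n ω))) (x n ω))
      atTop (fun z : ℝ => z ^ 2) (fun _ => P) (gaussianReal 0 1) ∧
    -- the average in the pseudo-value is taken with the population quantile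
    TendstoInDistribution
      (fun (n : ℕ) ω => GenLorenz.sigmaPSq μ t₀ / GenLorenz.sigmaVSq μ t₀ *
        GenLorenz.adjustedLogLikRatio t₀ θ (a n ω)
          (GenLorenz.average (GenLorenz.centered ψ θ (x n ω))) (x n ω))
      atTop (fun z : ℝ => z ^ 2) (fun _ => P) (gaussianReal 0 1) := by
  obtain rfl : x = fun (n : ℕ) ω (i : Fin n) => X i ω := by
    ext n ω i
    exact hx n ω i
  subst hθ hψ
  have hX : ∀ n : ℕ, AEMeasurable (fun ω => fun i : Fin n => X i ω) P := fun n =>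
    aemeasurable_pi_iff.2 fun i => (hident i).aemeasurable_fst
  have hint : MemLp id 2 μ := by
    rw [hμ, memLp_map_measure_iff aestronglyMeasurable_id (hident 0).aemeasurable_fst]
    exact hmom
  have ha' := GenLorenz.tendsto_div_natCast_of_rpow ha
  constructor
  -- The bound 1 + K: √n times this average differs from T by a null sequence, eventually by at most
  -- 1.
  · refine GenLorenz.tendstoInDistribution_adjustedLogLikRatio hindep hident hμ hint ht₀ hcont
      huniq ha_meas (fun n => ?_) ha' fun K => ⟨1 + K, ?_⟩
    · exact GenLorenz.measurable_average.comp_aemeasurable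
        ((GenLorenz.measurable_centered _).comp_aemeasurable
          (((GenLorenz.measurable_sampleQuantile ht₀).comp_aemeasurable (hX n)).prodMk (hX n)))
    · have h := GenLorenz.tendsto_sqrt_mul_average_sub (θ := GenLorenz.lorenzOrdinate μ t₀)
        (L := GenLorenz.inProbability P ⊓ 𝓟 {p : ℕ × Ω |
          |GenLorenz.normalizedShift (GenLorenz.quantile μ t₀) (GenLorenz.lorenzOrdinate μ t₀) t₀
            (fun i : Fin p.1 => X i p.2)| ≤ K ∧
          |GenLorenz.normalizedCount (GenLorenz.quantile μ t₀) t₀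
            (fun i : Fin p.1 => X i p.2)| ≤ K})
        (GenLorenz.tendsto_nat_inProbability.mono_left inf_le_left)
        ((GenLorenz.tendsto_sampleQuantile hindep hident hμ ht₀ huniq).mono_left inf_le_left)
        ((GenLorenz.eventually_abs_empiricalCDF_sampleQuantile_sub_le hindep hident hμ ht₀ hcont
          huniq).filter_mono inf_le_left)
        (eventually_inf_principal.2 (Eventually.of_forall fun p h => h.2))
      filter_upwards [h.abs.eventually_le_const (show |(0 : ℝ)| < 1 by simp),
        mem_inf_of_right (mem_principal_self _)] with p h1 h2
      have h3 := (abs_le.1 h1)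
      have h4 := (abs_le.1 h2.1)
      exact abs_le.2 ⟨by linarith, by linarith⟩
  -- Here √n times the average is exactly T + ψ U, with U the normalized count.
  · refine GenLorenz.tendstoInDistribution_adjustedLogLikRatio hindep hident hμ hint ht₀ hcont
      huniq ha_meas (fun n => ?_) ha' fun K => ⟨K + |GenLorenz.quantile μ t₀| * K, ?_⟩
    · exact GenLorenz.measurable_average.comp_aemeasurable
        ((GenLorenz.measurable_centered _).comp_aemeasurable (aemeasurable_const.prodMk (hX n)))
    · filter_upwards [mem_inf_of_right (mem_principal_self _),
        mem_inf_of_left GenLorenz.eventually_ne_zero_inProbability] with p h1 h2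
      rw [GenLorenz.sqrt_mul_average_centered h2 _ _ t₀]
      refine (abs_add_le _ _).trans (add_le_add h1.1 ?_)
      rw [abs_mul]
      exact mul_le_mul_of_nonneg_left h1.2 (abs_nonneg _)
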